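/- For $0<\alpha\le 2$ let $f_\alpha$ be the (continuous) probability density function of the symmetric $\alpha$-stable law with characteristic function $\omega\mapsto e^{-|\omega|^\alpha/\alpha}$, and let $h_\alpha=-\int_{\mathbb R} f_\alpha\log f_\alpha$ be its differential entropy. For a real random variable $Y$ define its strength $$s_\alpha(Y)=\inf\{s>0:\ -\mathbb E[\log f_\alpha(Y/s)]\le h_\alpha\},$$ and say that $s_\alpha(Y)$ exists if this set is nonempty. Let $0<\alpha\le 2$ and let $X$ be a real random variable that has a probability density function and whose strength $s_\alpha(X)$ exists. For $\Delta>0$ let $\hat X_\Delta$ be the uniformly quantized version of $X$: $\hat X_\Delta=k\Delta$ whenever $X\in(k\Delta-\Delta/2,\,k\Delta+\Delta/2]$, $k\in\mathbb Z$. Let $U$ be uniformly distributed on $(-1/2,1/2)$. Then $s_\alpha(U)$ and $s_\alpha(X-\hat X_\Delta)$, for every $\Delta>0$, exist, and $$\frac{s_\alpha(X-\hat X_\Delta)}{\Delta}\longrightarrow s_\alpha(U)\qquad\text{as }\Delta\to 0^+ .$$ Moreover, $s_2(U)=\sqrt{1/12}$. -/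

import Mathlib

open MeasureTheory ProbabilityTheory Filter Topology

noncomputable section

/-- Characteristic function `ω ↦ exp (-γ^α |ω|^α)` of the symmetric `α`-stable law `S(α, γ)`. -/
def sasCharFun (α γ ω : ℝ) : ℝ :=
  Real.exp (-(γ ^ α * |ω| ^ α))

/-- The (continuous) probability density function of `S(α, γ)`: the characteristic function is
integrable for `α, γ > 0`, so the density is given everywhere by the Fourier inversion formula
`f(x) = (2π)⁻¹ ∫ e^{-iωx} φ(ω) dω`. -/
def sasDensity (α γ x : ℝ) : ℝ :=
  (2 * Real.pi)⁻¹ *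
    (∫ ω : ℝ, Complex.exp (-((ω : ℂ) * (x : ℂ) * Complex.I)) * (sasCharFun α γ ω : ℂ)).re

/-- Density of the reference variable `Z̃_α ∼ S(α, (1/α)^(1/α))`. -/
def refDensity (α x : ℝ) : ℝ :=
  sasDensity α ((1 / α) ^ (1 / α)) x

/-- Differential entropy `h(Z̃_α)` of the reference variable. -/
def refEntropy (α : ℝ) : ℝ :=
  -∫ x : ℝ, refDensity α x * Real.log (refDensity α x)

/-- The levels `s > 0` with `-E[log f_{Z̃_α}(Y / s)] ≤ h(Z̃_α)`, the expectation being finite. Since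
`-log f_{Z̃_α}` is bounded below, the expectation is `+∞` when the integrand is not integrable, and
the inequality then fails. -/
def strengthSet {Ω : Type*} [MeasurableSpace Ω] (α : ℝ) (Y : Ω → ℝ) (P : Measure Ω) : Set ℝ :=
  {s : ℝ | 0 < s ∧ Integrable (fun w => Real.log (refDensity α (Y w / s))) P ∧
    -(∫ w, Real.log (refDensity α (Y w / s)) ∂P) ≤ refEntropy α}

/-- The strength of `Y` exists: the infimum defining it is over a nonempty set. -/
def StrengthExists {Ω : Type*} [MeasurableSpace Ω] (α : ℝ) (Y : Ω → ℝ) (P : Measure Ω) : Prop :=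
  (strengthSet α Y P).Nonempty

/-- The strength (`α`-power) `s_α(Y)` of a real random variable `Y`. -/
def strength {Ω : Type*} [MeasurableSpace Ω] (α : ℝ) (Y : Ω → ℝ) (P : Measure Ω) : ℝ :=
  sInf (strengthSet α Y P)

/-- The uniform quantizer with step `Δ > 0`, which sends the cell `(kΔ - Δ/2, kΔ + Δ/2]` to `kΔ`. -/
def uniformQuantizer (Δ x : ℝ) : ℝ :=
  (⌈x / Δ - 1 / 2⌉ : ℤ) * Δ

theorem uniformQuantizer_eq {Δ : ℝ} (hΔ : 0 < Δ) (k : ℤ) {x : ℝ}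
    (hx : x ∈ Set.Ioc (k * Δ - Δ / 2) (k * Δ + Δ / 2)) : uniformQuantizer Δ x = k * Δ := by
  obtain ⟨h1, h2⟩ := hx
  have h : ⌈x / Δ - 1 / 2⌉ = k := by
    rw [Int.ceil_eq_iff]
    constructor
    · have : (k : ℝ) - 1 / 2 < x / Δ := by rw [lt_div_iff₀ hΔ]; linarith
      linarith
    · have : x / Δ ≤ (k : ℝ) + 1 / 2 := by rw [div_le_iff₀ hΔ]; linarith
      linarith
  rw [uniformQuantizer, h]

end

/-! The error divided by `Δ` is `X / Δ` reduced mod 1 to `(-1/2, 1/2]`. Its nontrivial Fourier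
coefficients are values of the Fourier transform of the density of `X` at frequencies of order `1 /
Δ`, so they vanish by Riemann–Lebesgue and the normalized error becomes uniform
(`tendsto_integral_quantizationError`). Since `log f_α` is continuous and even, for each `t` the
level `-E[log f_α(error / (Δ t))]` tends to the level `-E[log f_α(U / t)]`. Levels decrease in `t`,
so the infima converge provided the level of `U` is strictly above `h_α` before `s_α(U)` and
strictly below it after. The second strictness is the delicate one
(`lt_refEntropy_of_strength_uniform_lt`); it rests on `-log f_α(0) < h_α`.

All this needs `f_α` positive, even, decreasing in `|x|`, of mass one, with `f_α log f_α`
integrable. The source is subordination: with `α = 2β`, `exp (-a|ω|^α)` is a limit of powers of `1 -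
(1 - exp (-δω²))^β`, and `1 - (1 - x)^β` has nonnegative coefficients. Hence `f_α` is a limit of
nonnegative sums of Gaussians, and inherits unimodality and log-convexity in `x²`. Log-convexity
gives positivity; unimodality turns an averaged bound into the tail bound `O(|x|^(-1-α))`, which
yields the integrability. -/

/-- The cosine transform `x ↦ ∫ cos (ω x) ψ(ω) dω`. -/
noncomputable def cosTransform (ψ : ℝ → ℝ) (x : ℝ) : ℝ := ∫ ω : ℝ, Real.cos (ω * x) * ψ ω

/-! ### Functions resembling mixtures of centred Gaussians -/

/-- Properties shared by all mixtures of centred Gaussian densities: nonnegativity, symmetric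
unimodality and midpoint log-convexity in the variable `x ^ 2`. -/
structure IsGaussianMixtureLike (F : ℝ → ℝ) : Prop where
  nonneg : ∀ x, 0 ≤ F x
  anti : ∀ x y, |x| ≤ |y| → F y ≤ F x
  logConvex : ∀ x y z, x ^ 2 + y ^ 2 = 2 * z ^ 2 → F z ^ 2 ≤ F x * F y

namespace IsGaussianMixtureLike

theorem gaussian {c b : ℝ} (hc : 0 ≤ c) (hb : 0 ≤ b) :
    IsGaussianMixtureLike fun x => c * Real.exp (-(b * x ^ 2)) where
  nonneg x := by positivity
  anti x y h := by
    have := sq_le_sq.2 h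
    gcongr
  logConvex x y z h := by
    refine le_of_eq ?_
    have : Real.exp (-(b * z ^ 2)) ^ 2 = Real.exp (-(b * x ^ 2)) * Real.exp (-(b * y ^ 2)) := by
      rw [← Real.exp_add, ← Real.exp_nat_mul]
      congr 1
      push_cast
      linear_combination b * h
    linear_combination c ^ 2 * this

theorem zero : IsGaussianMixtureLike fun _ => 0 where
  nonneg _ := le_rfl
  anti _ _ _ := le_rfl
  logConvex _ _ _ _ := by simp

theorem add {F G : ℝ → ℝ} (hF : IsGaussianMixtureLike F) (hG : IsGaussianMixtureLike G) :
    IsGaussianMixtureLike fun x => F x + G x where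
  nonneg x := add_nonneg (hF.nonneg x) (hG.nonneg x)
  anti x y h := add_le_add (hF.anti x y h) (hG.anti x y h)
  logConvex x y z h := by
    have h1 := hF.logConvex x y z h
    have h2 := hG.logConvex x y z h
    have a1 := hF.nonneg x
    have a2 := hF.nonneg y
    have a3 := hF.nonneg z
    have b1 := hG.nonneg x
    have b2 := hG.nonneg y
    have b3 := hG.nonneg z
    -- Only the cross term of `(F z + G z)²` needs work: multiply the two log-convexity bounds, then
    -- apply AM-GM to `F x * G y` and `G x * F y`.
    have key : 2 * (F z * G z) ≤ F x * G y + G x * F y := by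
      refine abs_le_of_sq_le_sq' ?_ (by positivity) |>.2
      have : (F z * G z) ^ 2 ≤ (F x * F y) * (G x * G y) := by
        rw [mul_pow]
        exact mul_le_mul h1 h2 (sq_nonneg _) (mul_nonneg a1 a2)
      nlinarith [sq_nonneg (F x * G y - G x * F y)]
    nlinarith

theorem const_mul {F : ℝ → ℝ} (hF : IsGaussianMixtureLike F) {c : ℝ} (hc : 0 ≤ c) :
    IsGaussianMixtureLike fun x => c * F x where
  nonneg x := mul_nonneg hc (hF.nonneg x)
  anti x y h := mul_le_mul_of_nonneg_left (hF.anti x y h) hc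
  logConvex x y z h := by
    have := mul_le_mul_of_nonneg_left (hF.logConvex x y z h) (sq_nonneg c)
    linarith

theorem of_tendsto {ι : Type*} {l : Filter ι} [l.NeBot] {F : ι → ℝ → ℝ} {G : ℝ → ℝ}
    (hF : ∀ i, IsGaussianMixtureLike (F i)) (h : ∀ x, Tendsto (fun i => F i x) l (𝓝 (G x))) :
    IsGaussianMixtureLike G where
  nonneg x := ge_of_tendsto' (h x) fun i => (hF i).nonneg x
  anti x y hxy := le_of_tendsto_of_tendsto' (h y) (h x) fun i => (hF i).anti x y hxy
  logConvex x y z hz := le_of_tendsto_of_tendsto' ((h z).pow 2) ((h x).mul (h y))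
    fun i => (hF i).logConvex x y z hz

theorem even {F : ℝ → ℝ} (hF : IsGaussianMixtureLike F) (x : ℝ) : F (-x) = F x :=
  le_antisymm (hF.anti _ _ (by simp)) (hF.anti _ _ (by simp))

/-- Log-convexity between `0` and `y` propagates a zero at `y` to `y / √2`. Iterating, zeros
accumulate at the origin, against continuity and `F 0 ≠ 0`. -/
theorem pos {F : ℝ → ℝ} (hF : IsGaussianMixtureLike F) (hc : ContinuousAt F 0) (h0 : F 0 ≠ 0)
    (x : ℝ) : 0 < F x := by
  refine lt_of_le_of_ne (hF.nonneg x) fun hx => h0 ?_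
  have hr : 0 < Real.sqrt 2 := by positivity
  have hr2 : Real.sqrt 2 ^ 2 = 2 := Real.sq_sqrt (by norm_num)
  have hstep : ∀ y, F y = 0 → F ((Real.sqrt 2)⁻¹ * y) = 0 := by
    intro y hy
    have := hF.logConvex 0 y ((Real.sqrt 2)⁻¹ * y) (by rw [mul_pow, inv_pow, hr2]; ring)
    rw [hy, mul_zero] at this
    exact pow_eq_zero_iff two_ne_zero |>.1 (le_antisymm this (sq_nonneg _))
  have hall : ∀ n : ℕ, F ((Real.sqrt 2)⁻¹ ^ n * x) = 0 := by
    intro n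
    induction n with
    | zero => simpa using hx.symm
    | succ n ih => rw [pow_succ', mul_assoc]; exact hstep _ ih
  have hlim : Tendsto (fun n : ℕ => (Real.sqrt 2)⁻¹ ^ n * x) atTop (𝓝 0) := by
    have := (tendsto_pow_atTop_nhds_zero_of_lt_one (r := (Real.sqrt 2)⁻¹) (by positivity)
      (inv_lt_one_of_one_lt₀ (by rw [Real.lt_sqrt] <;> norm_num))).mul_const x
    simpa using this
  have h2 : Tendsto (fun n : ℕ => F ((Real.sqrt 2)⁻¹ ^ n * x)) atTop (𝓝 (F 0)) :=
    hc.tendsto.comp hlim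
  simp only [hall] at h2
  exact tendsto_nhds_unique h2 tendsto_const_nhds

end IsGaussianMixtureLike

/-! ### Cosine transforms of Gaussian sums -/

theorem integrable_cos_mul {ψ : ℝ → ℝ} (hψ : Integrable ψ) (x : ℝ) :
    Integrable fun ω : ℝ => Real.cos (ω * x) * ψ ω := by
  refine hψ.bdd_mul (c := 1) (by fun_prop) (ae_of_all _ fun ω => ?_)
  simpa using Real.abs_cos_le_one (ω * x)

theorem cosTransform_gaussian {b : ℝ} (hb : 0 < b) (x : ℝ) :
    cosTransform (fun ω => Real.exp (-(b * ω ^ 2))) x =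
      Real.sqrt (Real.pi / b) * Real.exp (-((4 * b)⁻¹ * x ^ 2)) := by
  have h := congrArg Complex.re (fourierIntegral_gaussian (b := (b : ℂ)) (by simpa using hb) x)
  have hint : Integrable fun ω : ℝ =>
      Complex.exp (Complex.I * x * ω) * Complex.exp (-(b : ℂ) * ω ^ 2) := by
    have hg : Integrable fun ω : ℝ => ((Real.exp (-b * ω ^ 2) : ℝ) : ℂ) :=
      (integrable_exp_neg_mul_sq hb).ofReal
    refine (hg.bdd_mul (c := 1) (f := fun ω : ℝ => Complex.exp (Complex.I * x * ω))
      (by fun_prop) (ae_of_all _ fun ω => ?_)).congr (ae_of_all _ fun ω => ?_)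
    · rw [mul_assoc, mul_comm, ← Complex.ofReal_mul, Complex.norm_exp_ofReal_mul_I]
    · push_cast; rfl
  have h1 := integral_re hint
  simp only [RCLike.re_to_complex] at h1
  rw [← h1] at h
  have e1 : ∀ ω : ℝ, (Complex.exp (Complex.I * x * ω) * Complex.exp (-(b : ℂ) * ω ^ 2)).re =
      Real.cos (ω * x) * Real.exp (-(b * ω ^ 2)) := by
    intro ω
    have : Complex.exp (-(b : ℂ) * ω ^ 2) = ((Real.exp (-(b * ω ^ 2)) : ℝ) : ℂ) := by
      push_cast; ring_nf
    rw [this, Complex.re_mul_ofReal, show Complex.I * x * ω = ((ω * x : ℝ) : ℂ) * Complex.I by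
      push_cast; ring, Complex.exp_ofReal_mul_I_re]
  simp only [e1] at h
  rw [cosTransform, h]
  have e2 : ((Real.pi : ℂ) / b) ^ (1 / 2 : ℂ) = ((Real.sqrt (Real.pi / b) : ℝ) : ℂ) := by
    rw [Real.sqrt_eq_rpow, Complex.ofReal_cpow (by positivity)]
    push_cast; rfl
  have e3 : Complex.exp (-(x : ℂ) ^ 2 / (4 * b)) =
      ((Real.exp (-((4 * b)⁻¹ * x ^ 2)) : ℝ) : ℂ) := by
    push_cast
    congr 1
    ring
  rw [e2, e3, ← Complex.ofReal_mul, Complex.ofReal_re]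

/-- Finite sums of nonnegative multiples of integrable Gaussians. -/
inductive IsGaussianSum : (ℝ → ℝ) → Prop
  | zero : IsGaussianSum fun _ => 0
  | gaussian {c b : ℝ} (hc : 0 ≤ c) (hb : 0 < b) :
      IsGaussianSum fun ω => c * Real.exp (-(b * ω ^ 2))
  | add {f g : ℝ → ℝ} : IsGaussianSum f → IsGaussianSum g → IsGaussianSum fun ω => f ω + g ω

namespace IsGaussianSum

theorem mul {f g : ℝ → ℝ} (hf : IsGaussianSum f) (hg : IsGaussianSum g) :
    IsGaussianSum fun ω => f ω * g ω := by
  induction hf with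
  | zero => simpa using IsGaussianSum.zero
  | @gaussian c b hc hb =>
    induction hg with
    | zero => simpa using IsGaussianSum.zero
    | @gaussian c' b' hc' hb' =>
      have := IsGaussianSum.gaussian (mul_nonneg hc hc') (add_pos hb hb')
      convert this using 2 with ω
      rw [add_mul, neg_add, Real.exp_add]
      ring
    | add _ _ h1 h2 => simpa only [mul_add] using h1.add h2
  | add _ _ h1 h2 => simpa only [add_mul] using h1.add h2

theorem pow {f : ℝ → ℝ} (hf : IsGaussianSum f) (n : ℕ) :
    IsGaussianSum fun ω => f ω ^ (n + 1) := by
  induction n with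
  | zero => simpa using hf
  | succ n ih => simpa only [pow_succ _ (n + 1)] using ih.mul hf

theorem integrable {f : ℝ → ℝ} (hf : IsGaussianSum f) : Integrable f := by
  induction hf with
  | zero => exact integrable_zero _ _ _
  | @gaussian c b hc hb => simpa using (integrable_exp_neg_mul_sq hb).const_mul c
  | add _ _ h1 h2 => exact h1.add h2

theorem cosTransform_isGaussianMixtureLike {f : ℝ → ℝ} (hf : IsGaussianSum f) :
    IsGaussianMixtureLike (cosTransform f) := by
  induction hf with
  | zero =>
    have : cosTransform (fun _ => 0) = fun _ => 0 := by ext; simp [cosTransform]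
    rw [this]; exact .zero
  | @gaussian c b hc hb =>
    have : cosTransform (fun ω => c * Real.exp (-(b * ω ^ 2))) =
        fun x => (c * Real.sqrt (Real.pi / b)) * Real.exp (-((4 * b)⁻¹ * x ^ 2)) := by
      ext x
      rw [mul_assoc, ← cosTransform_gaussian hb, cosTransform, cosTransform, ← integral_const_mul]
      congr 1; ext ω; ring
    rw [this]
    exact .gaussian (by positivity) (by positivity)
  | @add f g hf hg h1 h2 =>
    have : cosTransform (fun ω => f ω + g ω) = fun x => cosTransform f x + cosTransform g x := by
      ext x
      simp only [cosTransform, mul_add]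
      exact integral_add (integrable_cos_mul hf.integrable x) (integrable_cos_mul hg.integrable x)
    rw [this]
    exact h1.add h2

end IsGaussianSum

theorem tendsto_cosTransform {ψ : ℕ → ℝ → ℝ} {φ B : ℝ → ℝ} (hm : ∀ n, AEStronglyMeasurable (ψ n))
    (hB : Integrable B) (hle : ∀ n, ∀ᵐ ω, |ψ n ω| ≤ B ω)
    (hlim : ∀ᵐ ω, Tendsto (fun n => ψ n ω) atTop (𝓝 (φ ω))) (x : ℝ) :
    Tendsto (fun n => cosTransform (ψ n) x) atTop (𝓝 (cosTransform φ x)) := by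
  refine tendsto_integral_of_dominated_convergence B
    (fun n => ((by fun_prop : Continuous fun ω : ℝ => Real.cos (ω * x)).aestronglyMeasurable.mul
      (hm n))) hB (fun n => ?_) ?_
  · filter_upwards [hle n] with ω hω
    rw [Real.norm_eq_abs, abs_mul]
    calc _ ≤ 1 * |ψ n ω| := by gcongr; exact Real.abs_cos_le_one _
      _ ≤ B ω := by rwa [one_mul]
  · filter_upwards [hlim] with ω hω using hω.const_mul _

/-! ### Stable characteristic functions as limits of Gaussian sums -/

/-- Coefficients of the power series of `1 - (1 - x) ^ β`. -/
noncomputable def sibuyaCoeff (β : ℝ) (k : ℕ) : ℝ := -((-1) ^ (k + 1) * Ring.choose β (k + 1))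

/-- Consecutive coefficients satisfy `(k + 2) c_{k+1} = (k + 1 - β) c_k`, and the factor is
nonnegative because `β ≤ 1`. -/
theorem sibuyaCoeff_nonneg {β : ℝ} (h0 : 0 ≤ β) (h1 : β ≤ 1) (k : ℕ) : 0 ≤ sibuyaCoeff β k := by
  induction k with
  | zero => simpa [sibuyaCoeff] using h0
  | succ k ih =>
    have h := Ring.choose_smul_choose β (n := k + 2) (k := k + 1) (by omega)
    have e : (k + 2 - (k + 1) : ℕ) = 1 := by omega
    rw [e, Ring.choose_one_right, Nat.choose_succ_self_right, nsmul_eq_mul] at h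
    push_cast at h
    have h2 : ((k : ℝ) + 2) * sibuyaCoeff β (k + 1) = sibuyaCoeff β k * ((k : ℝ) + 1 - β) := by
      simp only [sibuyaCoeff]
      linear_combination (-(-1 : ℝ) ^ (k + 1 + 1)) * h
    have h3 : 0 ≤ ((k : ℝ) + 2) * sibuyaCoeff β (k + 1) := by
      rw [h2]
      have : (0 : ℝ) ≤ k := Nat.cast_nonneg k
      exact mul_nonneg ih (by linarith)
    exact nonneg_of_mul_nonneg_right h3 (by positivity)

theorem hasSum_sibuyaCoeff (β : ℝ) {x : ℝ} (h0 : 0 ≤ x) (h1 : x < 1) :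
    HasSum (fun k => sibuyaCoeff β k * x ^ (k + 1)) (1 - (1 - x) ^ β) := by
  have h := (Real.one_add_rpow_hasFPowerSeriesOnBall_zero (a := β)).hasSum (y := -x) (by
    simp [Metric.mem_eball, edist_dist, abs_of_nonneg h0, h1])
  simp only [binomialSeries_apply, List.ofFn_const, List.prod_replicate, smul_eq_mul,
    zero_add] at h
  have h2 := ((hasSum_nat_add_iff' 1).2 h).neg
  simp only [Finset.range_one, Finset.sum_singleton, Ring.choose_zero_right, pow_zero,
    mul_one, neg_sub] at h2
  have e : (fun k => sibuyaCoeff β k * x ^ (k + 1)) =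
      fun k => -(Ring.choose β (k + 1) * (-x) ^ (k + 1)) := by
    ext k
    rw [sibuyaCoeff, neg_pow x]
    ring
  rw [e, sub_eq_add_neg 1 x]
  exact h2

theorem isGaussianSum_sibuya {β δ : ℝ} (h0 : 0 ≤ β) (h1 : β ≤ 1) (hδ : 0 < δ) (N : ℕ) :
    IsGaussianSum fun ω => ∑ k ∈ Finset.range N,
      sibuyaCoeff β k * Real.exp (-(δ * ω ^ 2)) ^ (k + 1) := by
  induction N with
  | zero => simpa using IsGaussianSum.zero
  | succ N ih =>
    simp only [Finset.sum_range_succ]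
    refine ih.add ?_
    have := IsGaussianSum.gaussian (sibuyaCoeff_nonneg h0 h1 N)
      (b := (N + 1) * δ) (by positivity)
    convert this using 3 with ω
    rw [← Real.exp_nat_mul]
    congr 1
    push_cast
    ring

/-- Supplies a dominating function uniform in `n`: with `u = δ_n ω²` and `δ_n^β = a / (n + 1)`, the
`(n + 1)`-st power of the right side is `exp (-(a/2)|ω|^(2β))`. For `u ≤ 1` use `1 - exp (-u) ≥ u /
2`; for `u ≥ 1` the left side is at most `exp (-u)`. -/
theorem one_sub_rpow_le_exp {β u : ℝ} (h0 : 0 < β) (h1 : β ≤ 1) (hu : 0 < u) :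
    1 - (1 - Real.exp (-u)) ^ β ≤ Real.exp (-(u ^ β / 2)) := by
  have hE : Real.exp (-u) < 1 := by simpa using hu
  have hE0 := Real.exp_pos (-u)
  rcases le_total u 1 with h | h
  · have hinv : Real.exp (-u) ≤ (1 + u)⁻¹ := by
      rw [Real.exp_neg]
      exact inv_anti₀ (by linarith) (by linarith [Real.add_one_le_exp u])
    have hu2 : u / 2 ≤ 1 - Real.exp (-u) := by
      have : (1 + u)⁻¹ ≤ 1 - u / 2 := by
        rw [inv_le_iff_one_le_mul₀ (by linarith)]
        nlinarith
      linarith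
    have h3 : u ^ β / 2 ≤ (1 - Real.exp (-u)) ^ β := by
      calc u ^ β / 2 ≤ u ^ β / 2 ^ β := by
            gcongr
            exact (Real.rpow_le_rpow_of_exponent_le one_le_two h1).trans (by simp)
        _ = (u / 2) ^ β := (Real.div_rpow hu.le zero_le_two β).symm
        _ ≤ _ := Real.rpow_le_rpow (by positivity) hu2 h0.le
    calc _ ≤ Real.exp (-(1 - Real.exp (-u)) ^ β) := by
          linarith [Real.add_one_le_exp (-(1 - Real.exp (-u)) ^ β)]
      _ ≤ _ := by gcongr
  · have h3 : 1 - Real.exp (-u) ≤ (1 - Real.exp (-u)) ^ β := by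
      have := Real.rpow_le_rpow_of_exponent_ge (x := 1 - Real.exp (-u)) (by linarith)
        (by linarith) h1
      simpa using this
    have h4 : u ^ β / 2 ≤ u := by
      have : u ^ β ≤ u := by simpa using Real.rpow_le_rpow_of_exponent_le h h1
      linarith
    calc _ ≤ Real.exp (-u) := by linarith
      _ ≤ _ := by gcongr

theorem integrable_comp_abs_of_integrableOn_Ioi {f : ℝ → ℝ} (hf : IntegrableOn f (Set.Ioi 0)) :
    Integrable fun x => f |x| := by
  have h1 : IntegrableOn (fun x => f |x|) (Set.Ioi 0) :=
    hf.congr_fun (fun x hx => by rw [abs_of_pos hx]) measurableSet_Ioi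
  have h2 : IntegrableOn (fun x => f |x|) (Set.Iio 0) := by
    rw [← (Measure.measurePreserving_neg (volume : Measure ℝ)).integrableOn_comp_preimage
      (Homeomorph.neg ℝ).measurableEmbedding]
    simpa [Function.comp_def] using h1
  rw [← integrableOn_univ, ← @Set.Iio_union_Ici _ _ (0 : ℝ), integrableOn_union,
    integrableOn_Ici_iff_integrableOn_Ioi]
  exact ⟨h2, h1⟩

theorem integrable_exp_neg_mul_abs_rpow {a α : ℝ} (ha : 0 < a) (hα : 0 < α) :
    Integrable fun ω : ℝ => Real.exp (-(a * |ω| ^ α)) := by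
  have h := integrableOn_rpow_mul_exp_neg_mul_rpow (s := 0) (p := α) (b := a) (by norm_num) hα ha
  simp only [Real.rpow_zero, one_mul, neg_mul] at h
  exact integrable_comp_abs_of_integrableOn_Ioi (f := fun x => Real.exp (-(a * x ^ α))) h

/-- With `δ = (a / n)^(1/β)`, `(1 - exp (-δu))^β` is asymptotic to `(δu)^β = a u^β / n`, so this is
the limit `(1 - c/n)^n → exp (-c)`. -/
theorem tendsto_sibuya_pow {β a u : ℝ} (h0 : 0 < β) (ha : 0 < a) (hu : 0 < u) :
    Tendsto (fun n : ℕ => (1 - (1 - Real.exp (-((a / (n + 1 : ℕ)) ^ (1 / β) * u))) ^ β) ^ (n + 1))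
      atTop (𝓝 (Real.exp (-(a * u ^ β)))) := by
  have key : Tendsto (fun n : ℕ => (1 - (1 - Real.exp (-((a / (n : ℕ)) ^ (1 / β) * u))) ^ β) ^ n)
      atTop (𝓝 (Real.exp (-(a * u ^ β)))) := by
    simp only [sub_eq_add_neg 1 ((1 - Real.exp _) ^ β)]
    refine Real.tendsto_one_add_pow_exp_of_tendsto ?_
    have hδ : Tendsto (fun n : ℕ => (a / (n : ℝ)) ^ (1 / β) * u) atTop (𝓝[≠] 0) := by
      refine tendsto_nhdsWithin_iff.2 ⟨?_, ?_⟩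
      · have h1 : Tendsto (fun n : ℕ => a / (n : ℝ)) atTop (𝓝 0) :=
          tendsto_const_div_atTop_nhds_zero_nat a
        have h2 := (h1.rpow_const (p := 1 / β) (Or.inr (by positivity))).mul_const u
        rwa [Real.zero_rpow (by positivity), zero_mul] at h2
      · filter_upwards [eventually_gt_atTop 0] with n hn
        have : (0 : ℝ) < n := Nat.cast_pos.2 hn
        simp only [Set.mem_compl_iff, Set.mem_singleton_iff]
        positivity
    have hd : HasDerivAt (fun t : ℝ => 1 - Real.exp (-t)) 1 0 := by
      have := ((hasDerivAt_neg (0 : ℝ)).exp).const_sub 1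
      simpa using this
    have hslope := (hasDerivAt_iff_tendsto_slope.1 hd).comp hδ
    have h3 := ((hslope.rpow_const (p := β) (Or.inr h0.le)).const_mul (a * u ^ β)).neg
    rw [Real.one_rpow, mul_one] at h3
    refine h3.congr' ?_
    filter_upwards [eventually_gt_atTop 0] with n hn
    have hn' : (0 : ℝ) < n := Nat.cast_pos.2 hn
    set d := (a / (n : ℝ)) ^ (1 / β) with hd'
    have hd0 : 0 < d := by positivity
    have hdb : d ^ β = a / n := by
      rw [hd', ← Real.rpow_mul (by positivity), one_div_mul_cancel h0.ne', Real.rpow_one]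
    have hnn : 0 ≤ 1 - Real.exp (-(d * u)) := by
      have : Real.exp (-(d * u)) ≤ 1 := by simp; positivity
      linarith
    simp only [Function.comp_apply, slope_def_field, neg_zero, Real.exp_zero, sub_self, sub_zero]
    rw [Real.div_rpow hnn (by positivity), Real.mul_rpow hd0.le hu.le, hdb]
    field_simp
  exact key.comp (tendsto_add_atTop_nat 1)

/-- The case `α = 2` is a single Gaussian. Otherwise two limits are taken under the same dominating
function `B`: the truncation length `N` of the binomial series, then the power `n + 1`. -/
theorem cosTransform_stable_isGaussianMixtureLike {α a : ℝ} (h0 : 0 < α) (h2 : α ≤ 2)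
    (ha : 0 < a) :
    IsGaussianMixtureLike (cosTransform fun ω => Real.exp (-(a * |ω| ^ α))) := by
  rcases h2.eq_or_lt with rfl | hlt
  · have := (IsGaussianSum.gaussian zero_le_one ha).cosTransform_isGaussianMixtureLike
    simpa using this
  obtain ⟨β, rfl⟩ : ∃ β, α = 2 * β := ⟨α / 2, by ring⟩
  have hβ0 : 0 < β := by linarith
  have hβ1 : β ≤ 1 := by linarith
  have hpow : ∀ ω : ℝ, |ω| ^ (2 * β) = (ω ^ 2) ^ β := fun ω => by
    rw [Real.rpow_mul (abs_nonneg _), Real.rpow_two, sq_abs]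
  -- At `ω = 0` the series variable `exp (-δω²)` equals `1`, outside the open disc of convergence.
  have hae : ∀ᵐ ω : ℝ, ω ≠ 0 := Measure.ae_ne volume 0
  set B : ℝ → ℝ := fun ω => Real.exp (-(a / 2 * |ω| ^ (2 * β))) with hB
  have hBi : Integrable B := integrable_exp_neg_mul_abs_rpow (by positivity) h0
  set δ : ℕ → ℝ := fun n => (a / (n + 1 : ℕ)) ^ (1 / β) with hδdef
  have hδ : ∀ n, 0 < δ n := fun n => by positivity
  have hδβ : ∀ n, δ n ^ β = a / (n + 1 : ℕ) := fun n => by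
    rw [hδdef, ← Real.rpow_mul (by positivity), one_div_mul_cancel hβ0.ne', Real.rpow_one]
  have hx : ∀ n (ω : ℝ), ω ≠ 0 → 0 < δ n * ω ^ 2 := fun n ω hω => by
    have := hδ n
    positivity
  have hle : ∀ n (ω : ℝ), ω ≠ 0 →
      (1 - (1 - Real.exp (-(δ n * ω ^ 2))) ^ β) ^ (n + 1) ≤ B ω := by
    intro n ω hω
    have hE : Real.exp (-(δ n * ω ^ 2)) ≤ 1 := by simpa using (hx n ω hω).le
    have hE0 := Real.exp_pos (-(δ n * ω ^ 2))
    have h1 : 0 ≤ 1 - (1 - Real.exp (-(δ n * ω ^ 2))) ^ β := by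
      have := Real.rpow_le_one (x := 1 - Real.exp (-(δ n * ω ^ 2))) (by linarith)
        (by linarith) hβ0.le
      linarith
    refine (pow_le_pow_left₀ h1 (one_sub_rpow_le_exp hβ0 hβ1 (hx n ω hω)) _).trans (le_of_eq ?_)
    simp only [hB]
    rw [← Real.exp_nat_mul, Real.mul_rpow (hδ n).le (sq_nonneg _), hδβ, hpow]
    congr 1
    have : ((n + 1 : ℕ) : ℝ) ≠ 0 := by positivity
    field_simp
  have hsum := fun n (ω : ℝ) (hω : ω ≠ 0) => hasSum_sibuyaCoeff β (Real.exp_pos _).le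
    (show Real.exp (-(δ n * ω ^ 2)) < 1 by simpa using hx n ω hω)
  have step : ∀ n, IsGaussianMixtureLike (cosTransform fun ω =>
      (1 - (1 - Real.exp (-(δ n * ω ^ 2))) ^ β) ^ (n + 1)) := by
    intro n
    have hG := fun N => (isGaussianSum_sibuya hβ0.le hβ1 (hδ n) N).pow n
    refine IsGaussianMixtureLike.of_tendsto (l := atTop)
      (fun N => (hG N).cosTransform_isGaussianMixtureLike) ?_
    refine tendsto_cosTransform (fun N => (hG N).integrable.aestronglyMeasurable) hBi ?_ ?_
    · intro N
      filter_upwards [hae] with ω hω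
      have hterm : ∀ k, 0 ≤ sibuyaCoeff β k * Real.exp (-(δ n * ω ^ 2)) ^ (k + 1) := fun k =>
        mul_nonneg (sibuyaCoeff_nonneg hβ0.le hβ1 k) (by positivity)
      have hS := Finset.sum_nonneg fun k (_ : k ∈ Finset.range N) => hterm k
      rw [abs_of_nonneg (pow_nonneg hS _)]
      refine (pow_le_pow_left₀ hS ?_ _).trans (hle n ω hω)
      exact sum_le_hasSum _ (fun k _ => hterm k) (hsum n ω hω)
    · filter_upwards [hae] with ω hω
      exact (hsum n ω hω).tendsto_sum_nat.pow _
  refine IsGaussianMixtureLike.of_tendsto (l := atTop) step ?_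
  refine tendsto_cosTransform (fun n => ?_) hBi ?_ ?_
  · exact (Measurable.aestronglyMeasurable (by fun_prop))
  · intro n
    filter_upwards [hae] with ω hω
    rw [abs_of_nonneg]
    · exact hle n ω hω
    · refine pow_nonneg ?_ _
      have hE : Real.exp (-(δ n * ω ^ 2)) ≤ 1 := by simpa using (hx n ω hω).le
      have hE0 := Real.exp_pos (-(δ n * ω ^ 2))
      have := Real.rpow_le_one (x := 1 - Real.exp (-(δ n * ω ^ 2))) (by linarith)
        (by linarith) hβ0.le
      linarith
  · filter_upwards [hae] with ω hω
    rw [hpow]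
    exact tendsto_sibuya_pow hβ0 ha (by positivity)

/-! ### Gaussian-weighted integrals of cosine transforms -/

theorem continuous_cosTransform {ψ : ℝ → ℝ} (hψ : Integrable ψ) :
    Continuous (cosTransform ψ) := by
  refine continuous_of_dominated (bound := fun ω => |ψ ω|)
    (fun x => (integrable_cos_mul hψ x).aestronglyMeasurable) (fun x => ae_of_all _ fun ω => ?_)
    hψ.abs (ae_of_all _ fun ω => by fun_prop)
  rw [Real.norm_eq_abs, abs_mul]
  exact mul_le_of_le_one_left (abs_nonneg _) (Real.abs_cos_le_one _)

/-- Parseval against a Gaussian, by Fubini. As `r → 0` it converts the behaviour of `ψ` near `0`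
into information on large `x`; both the tail bound and the total mass come from it. -/
theorem integral_cosTransform_mul_gaussian {ψ : ℝ → ℝ} (hψ : Integrable ψ) {r : ℝ} (hr : 0 < r) :
    ∫ x, cosTransform ψ x * Real.exp (-((r * x) ^ 2)) =
      Real.sqrt Real.pi * ∫ v, ψ (r * v) * Real.exp (-(v ^ 2 / 4)) := by
  have hg : Integrable fun x : ℝ => Real.exp (-((r * x) ^ 2)) := by
    have := integrable_exp_neg_mul_sq (b := r ^ 2) (by positivity)
    simpa [mul_pow] using this
  have hprod : Integrable (Function.uncurry fun x ω : ℝ =>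
      Real.cos (ω * x) * ψ ω * Real.exp (-((r * x) ^ 2))) (volume.prod volume) := by
    have h1 := hg.mul_prod hψ
    refine (h1.bdd_mul (c := 1) (f := fun p : ℝ × ℝ => Real.cos (p.2 * p.1))
      (by fun_prop) (ae_of_all _ fun p => ?_)).congr (ae_of_all _ fun p => ?_)
    · simpa using Real.abs_cos_le_one _
    · simp only [Function.uncurry]; ring
  calc ∫ x, cosTransform ψ x * Real.exp (-((r * x) ^ 2))
      = ∫ x, ∫ ω, Real.cos (ω * x) * ψ ω * Real.exp (-((r * x) ^ 2)) := by
        simp only [cosTransform, integral_mul_const]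
    _ = ∫ ω, ∫ x, Real.cos (ω * x) * ψ ω * Real.exp (-((r * x) ^ 2)) :=
        integral_integral_swap hprod
    _ = ∫ ω, ψ ω * (Real.sqrt Real.pi / r * Real.exp (-((ω / r) ^ 2 / 4))) := by
        congr 1; ext ω
        have h := cosTransform_gaussian (b := r ^ 2) (by positivity) ω
        have e : (Real.sqrt Real.pi / r * Real.exp (-((ω / r) ^ 2 / 4))) =
            cosTransform (fun ω => Real.exp (-(r ^ 2 * ω ^ 2))) ω := by
          rw [h, Real.sqrt_div Real.pi_pos.le, Real.sqrt_sq hr.le]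
          congr 3
          field_simp
        rw [e, cosTransform, ← integral_const_mul]
        congr 1; ext x
        rw [mul_comm ω x, mul_pow]
        ring
    _ = _ := by
        have h := Measure.integral_comp_mul_left
          (fun ω => ψ ω * (Real.sqrt Real.pi / r * Real.exp (-((ω / r) ^ 2 / 4)))) r
        simp only [mul_div_cancel_left₀ _ hr.ne', abs_of_pos (inv_pos.2 hr), smul_eq_mul] at h
        have h' : ∫ ω, ψ ω * (Real.sqrt Real.pi / r * Real.exp (-((ω / r) ^ 2 / 4))) =
            r * ∫ v, ψ (r * v) * (Real.sqrt Real.pi / r * Real.exp (-(v ^ 2 / 4))) := by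
          rw [h, mul_inv_cancel_left₀ hr.ne']
        rw [h', ← integral_const_mul, ← integral_const_mul]
        congr 1; ext v; field_simp

theorem refDensity_eq {α : ℝ} (hα : 0 < α) (x : ℝ) :
    refDensity α x =
      (2 * Real.pi)⁻¹ * cosTransform (fun ω => Real.exp (-(1 / α * |ω| ^ α))) x := by
  have hγ : ((1 / α) ^ (1 / α)) ^ α = 1 / α := by
    rw [← Real.rpow_mul (by positivity), one_div_mul_cancel hα.ne', Real.rpow_one]
  have hψ := integrable_exp_neg_mul_abs_rpow (a := 1 / α) (by positivity) hα
  have hint : Integrable fun ω : ℝ => Complex.exp (-((ω : ℂ) * x * Complex.I)) *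
      ((Real.exp (-(1 / α * |ω| ^ α)) : ℝ) : ℂ) := by
    refine hψ.ofReal.bdd_mul (c := 1) (by fun_prop) (ae_of_all _ fun ω => ?_)
    rw [show -((ω : ℂ) * x * Complex.I) = ((-(ω * x) : ℝ) : ℂ) * Complex.I by push_cast; ring,
      Complex.norm_exp_ofReal_mul_I]
  have h1 := integral_re hint
  simp only [RCLike.re_to_complex] at h1
  simp only [refDensity, sasDensity, sasCharFun, hγ]
  rw [← h1, cosTransform]
  congr 2; ext ω
  rw [Complex.re_mul_ofReal,
    show -((ω : ℂ) * x * Complex.I) = ((-(ω * x) : ℝ) : ℂ) * Complex.I by push_cast; ring,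
    Complex.exp_ofReal_mul_I_re, Real.cos_neg]

theorem integrable_abs_rpow_mul_gaussian {α : ℝ} (hα : 0 < α) :
    Integrable fun v : ℝ => |v| ^ α * Real.exp (-(v ^ 2 / 4)) := by
  have h := integrableOn_rpow_mul_exp_neg_mul_sq (b := 1 / 4) (by norm_num) (s := α) (by linarith)
  have := integrable_comp_abs_of_integrableOn_Ioi
    (f := fun v => v ^ α * Real.exp (-(1 / 4) * v ^ 2)) h
  simp only [sq_abs] at this
  refine this.congr (ae_of_all _ fun v => ?_)
  dsimp only
  ring_nf

theorem integrable_exp_neg_sq_div_four : Integrable fun v : ℝ => Real.exp (-(v ^ 2 / 4)) := by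
  have := integrable_exp_neg_mul_sq (b := 1 / 4) (by norm_num)
  refine this.congr (ae_of_all _ fun v => ?_)
  dsimp only
  ring_nf

/-! ### Tail decay of stable transforms -/

section Stable

variable {α a : ℝ}

theorem abs_cosTransform_le {ψ : ℝ → ℝ} (x : ℝ) (hψ : Integrable ψ) :
    |cosTransform ψ x| ≤ ∫ ω, |ψ ω| := by
  refine (abs_integral_le_integral_abs).trans (integral_mono (integrable_cos_mul hψ x).abs hψ.abs
    fun ω => ?_)
  rw [abs_mul]
  exact mul_le_of_le_one_left (abs_nonneg _) (Real.abs_cos_le_one _)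

theorem integrable_cosTransform_mul_gaussian {ψ : ℝ → ℝ} (hψ : Integrable ψ) {r : ℝ}
    (hr : 0 < r) : Integrable fun x => cosTransform ψ x * Real.exp (-((r * x) ^ 2)) := by
  have hg : Integrable fun x : ℝ => Real.exp (-((r * x) ^ 2)) := by
    have := integrable_exp_neg_mul_sq (b := r ^ 2) (by positivity)
    simpa [mul_pow] using this
  exact hg.bdd_mul (c := ∫ ω, |ψ ω|) (continuous_cosTransform hψ).aestronglyMeasurable
    (ae_of_all _ fun x => abs_cosTransform_le x hψ)

theorem integrable_stable_mul_gaussian (ha : 0 < a) (r : ℝ) :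
    Integrable fun v : ℝ => Real.exp (-(a * |r * v| ^ α)) * Real.exp (-(v ^ 2 / 4)) := by
  refine integrable_exp_neg_sq_div_four.bdd_mul (c := 1)
    (Measurable.aestronglyMeasurable (by fun_prop)) (ae_of_all _ fun v => ?_)
  rw [Real.norm_eq_abs, Real.abs_exp, Real.exp_le_one_iff]
  have : 0 ≤ a * |r * v| ^ α := by positivity
  linarith

/-- Integrate the transform `F` against `exp (-(x/R)²) - exp (-(2x/R)²) ≥ 0`. On the Fourier side
the contributions of `ψ(0)` cancel, leaving `O(R^(-α))`. On `[R/2, R]` the weight is bounded below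
and `F ≥ F R`, so the integral is at least a constant times `R * F R`. -/
theorem cosTransform_stable_le (h0 : 0 < α) (h2 : α ≤ 2) (ha : 0 < a) :
    ∃ C, 0 ≤ C ∧ ∀ R, 0 < R →
      cosTransform (fun ω => Real.exp (-(a * |ω| ^ α))) R ≤ C * R ^ (-(1 + α)) := by
  set ψ : ℝ → ℝ := fun ω => Real.exp (-(a * |ω| ^ α)) with hψdef
  have hψ : Integrable ψ := integrable_exp_neg_mul_abs_rpow ha h0
  have hF : IsGaussianMixtureLike (cosTransform ψ) :=
    cosTransform_stable_isGaussianMixtureLike h0 h2 ha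
  set F := cosTransform ψ
  set M : ℝ := ∫ v : ℝ, |v| ^ α * Real.exp (-(v ^ 2 / 4)) with hM
  have hM0 : 0 ≤ M := integral_nonneg fun v => by positivity
  -- Lower bound of the weight at `x = R y`, `1/2 ≤ y ≤ 1`: `exp (-y²) (1 - exp (-3y²)) ≥ exp (-1)
  -- (1 - exp (-3/4))`.
  set c₀ : ℝ := Real.exp (-1) - Real.exp (-(7 / 4)) with hc₀
  have hc₀pos : 0 < c₀ := by
    rw [hc₀, sub_pos]; exact Real.exp_lt_exp.2 (by norm_num)
  refine ⟨2 * (Real.sqrt Real.pi * (a * 2 ^ α * M)) / c₀, by positivity, fun R hR => ?_⟩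
  have hr : 0 < R⁻¹ := inv_pos.2 hR
  have hr2 : 0 < 2 * R⁻¹ := by positivity
  have hI1 := integrable_cosTransform_mul_gaussian hψ hr
  have hI2 := integrable_cosTransform_mul_gaussian hψ hr2
  have upper : ∫ x, (F x * Real.exp (-((R⁻¹ * x) ^ 2)) -
      F x * Real.exp (-((2 * R⁻¹ * x) ^ 2))) ≤
      Real.sqrt Real.pi * (a * 2 ^ α * M) * R ^ (-α) := by
    rw [integral_sub hI1 hI2, integral_cosTransform_mul_gaussian hψ hr,
      integral_cosTransform_mul_gaussian hψ hr2, ← mul_sub,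
      ← integral_sub (integrable_stable_mul_gaussian ha _)
        (integrable_stable_mul_gaussian ha _), mul_assoc]
    refine mul_le_mul_of_nonneg_left ?_ (Real.sqrt_nonneg _)
    have e : a * 2 ^ α * M * R ^ (-α) =
        ∫ v : ℝ, (a * 2 ^ α * R ^ (-α)) * (|v| ^ α * Real.exp (-(v ^ 2 / 4))) := by
      rw [integral_const_mul]; ring
    rw [e]
    refine integral_mono ((integrable_stable_mul_gaussian ha _).sub
      (integrable_stable_mul_gaussian ha _))
      ((integrable_abs_rpow_mul_gaussian h0).const_mul _) fun v => ?_
    have h1 : ψ (R⁻¹ * v) ≤ 1 := by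
      simp only [hψdef]
      rw [Real.exp_le_one_iff]
      have : 0 ≤ a * |R⁻¹ * v| ^ α := by positivity
      linarith
    have h2 : 1 - a * (2 ^ α * R ^ (-α) * |v| ^ α) ≤ ψ (2 * R⁻¹ * v) := by
      have e2 : |2 * R⁻¹ * v| ^ α = 2 ^ α * R ^ (-α) * |v| ^ α := by
        rw [abs_mul, abs_of_pos hr2, Real.mul_rpow hr2.le (abs_nonneg _),
          Real.mul_rpow zero_le_two hr.le, Real.inv_rpow hR.le, Real.rpow_neg hR.le]
      simp only [hψdef, e2]
      linarith [Real.add_one_le_exp (-(a * (2 ^ α * R ^ (-α) * |v| ^ α)))]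
    have hE := Real.exp_pos (-(v ^ 2 / 4))
    change ψ (R⁻¹ * v) * _ - ψ (2 * R⁻¹ * v) * _ ≤ _
    nlinarith
  have lower : F R * c₀ * (R / 2) ≤ ∫ x, (F x * Real.exp (-((R⁻¹ * x) ^ 2)) -
      F x * Real.exp (-((2 * R⁻¹ * x) ^ 2))) := by
    have e : F R * c₀ * (R / 2) = ∫ x, (Set.Icc (R / 2) R).indicator (fun _ => F R * c₀) x := by
      rw [integral_indicator measurableSet_Icc, setIntegral_const, Real.volume_real_Icc_of_le
        (by linarith), smul_eq_mul]
      ring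
    rw [e]
    refine integral_mono ?_ (hI1.sub hI2) fun x => ?_
    · rw [integrable_indicator_iff measurableSet_Icc]
      exact continuousOn_const.integrableOn_Icc
    · have hnn : ∀ x, 0 ≤ F x * Real.exp (-((R⁻¹ * x) ^ 2)) -
          F x * Real.exp (-((2 * R⁻¹ * x) ^ 2)) := fun x => by
        rw [← mul_sub]
        refine mul_nonneg (hF.nonneg x) (sub_nonneg.2 (Real.exp_le_exp.2 ?_))
        nlinarith [sq_nonneg (R⁻¹ * x)]
      by_cases hx : x ∈ Set.Icc (R / 2) R
      · rw [Set.indicator_of_mem hx]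
        have hFx : F R ≤ F x := hF.anti x R (by
          rw [abs_of_nonneg (by linarith [hx.1]), abs_of_pos hR]; exact hx.2)
        obtain ⟨y, rfl⟩ : ∃ y, x = R * y := ⟨x / R, by field_simp⟩
        have hy1 : 1 / 2 ≤ y := by
          have := hx.1
          by_contra! h
          nlinarith
        have hy2 : y ≤ 1 := by
          have := hx.2
          by_contra! h
          nlinarith
        have e1 : R⁻¹ * (R * y) = y := inv_mul_cancel_left₀ hR.ne' y
        simp only [mul_assoc, e1]
        rw [← mul_sub]
        refine mul_le_mul hFx ?_ hc₀pos.le (hF.nonneg _)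
        have e2 : Real.exp (-((2 * y) ^ 2)) = Real.exp (-y ^ 2) * Real.exp (-(3 * y ^ 2)) := by
          rw [← Real.exp_add]; ring_nf
        have e3 : c₀ = Real.exp (-1) * (1 - Real.exp (-(3 / 4))) := by
          rw [hc₀, mul_sub, mul_one, ← Real.exp_add]; norm_num
        have e4 : Real.exp (-(3 / 4)) ≤ 1 := by rw [Real.exp_le_one_iff]; norm_num
        rw [e2, e3, ← mul_one_sub]
        refine mul_le_mul (Real.exp_le_exp.2 (by nlinarith)) ?_ (by linarith) (Real.exp_pos _).le
        refine sub_le_sub_left (Real.exp_le_exp.2 ?_) _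
        nlinarith
      · rw [Set.indicator_of_notMem hx]
        exact hnn x
  have hfin := lower.trans upper
  have e : R ^ (-(1 + α)) = R ^ (-α) / R := by
    rw [neg_add, add_comm, Real.rpow_add hR, Real.rpow_neg_one]; rfl
  rw [e]
  have hcR : 0 < c₀ * (R / 2) := by positivity
  calc F R ≤ Real.sqrt Real.pi * (a * 2 ^ α * M) * R ^ (-α) / (c₀ * (R / 2)) := by
        rw [le_div_iff₀ hcR]; linarith
    _ = _ := by field_simp

end Stable

/-! ### The reference density: positivity, tails, mass and entropy -/

section RefDensity

variable {α : ℝ}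

theorem refDensity_isGaussianMixtureLike (h0 : 0 < α) (h2 : α ≤ 2) :
    IsGaussianMixtureLike (refDensity α) := by
  rw [funext (refDensity_eq h0)]
  exact (cosTransform_stable_isGaussianMixtureLike h0 h2 (by positivity)).const_mul (by positivity)

theorem continuous_refDensity (h0 : 0 < α) : Continuous (refDensity α) := by
  rw [funext (refDensity_eq h0)]
  exact (continuous_cosTransform
    (integrable_exp_neg_mul_abs_rpow (by positivity) h0)).const_mul _

theorem refDensity_pos (h0 : 0 < α) (h2 : α ≤ 2) (x : ℝ) : 0 < refDensity α x := by
  refine (refDensity_isGaussianMixtureLike h0 h2).pos (continuous_refDensity h0).continuousAt ?_ x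
  rw [refDensity_eq h0]
  refine (mul_pos (by positivity) ?_).ne'
  simp only [cosTransform, mul_zero, Real.cos_zero, one_mul]
  exact integral_exp_pos (integrable_exp_neg_mul_abs_rpow (by positivity) h0)

theorem refDensity_le (h0 : 0 < α) (h2 : α ≤ 2) :
    ∃ K, 0 < K ∧ ∀ x, refDensity α x ≤ K * (1 + |x|) ^ (-(1 + α)) := by
  obtain ⟨C, hC, hle⟩ := cosTransform_stable_le h0 h2 (a := 1 / α) (by positivity)
  have hmix := refDensity_isGaussianMixtureLike h0 h2
  have hf0 := refDensity_pos h0 h2 0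
  set D := (2 * Real.pi)⁻¹ * C with hD
  have hD0 : 0 ≤ D := by positivity
  -- The factor `2 ^ (1 + α)` comes from `1 + |x| ≤ 2` when `|x| ≤ 1` and `1 + |x| ≤ 2|x|` when `|x|
  -- ≥ 1`.
  refine ⟨2 ^ (1 + α) * (D + refDensity α 0), by positivity, fun x => ?_⟩
  have hx1 : 0 < 1 + |x| := by positivity
  rcases le_total |x| 1 with h | h
  · have h3 : 1 ≤ 2 ^ (1 + α) * (1 + |x|) ^ (-(1 + α)) := by
      rw [Real.rpow_neg hx1.le, ← div_eq_mul_inv, one_le_div (by positivity)]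
      exact Real.rpow_le_rpow hx1.le (by linarith) (by linarith)
    calc refDensity α x ≤ refDensity α 0 := hmix.anti _ _ (by simp)
      _ ≤ D + refDensity α 0 := by linarith
      _ ≤ (D + refDensity α 0) * (2 ^ (1 + α) * (1 + |x|) ^ (-(1 + α))) :=
        le_mul_of_one_le_right (by positivity) h3
      _ = _ := by ring
  · have hxpos : 0 < |x| := by linarith
    have h3 : |x| ^ (-(1 + α)) ≤ 2 ^ (1 + α) * (1 + |x|) ^ (-(1 + α)) := by
      rw [Real.rpow_neg hx1.le, ← div_eq_mul_inv, Real.rpow_neg hxpos.le, inv_eq_one_div,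
        div_le_div_iff₀ (by positivity) (by positivity), one_mul,
        ← Real.mul_rpow zero_le_two hxpos.le]
      exact Real.rpow_le_rpow hx1.le (by linarith) (by linarith)
    calc refDensity α x ≤ refDensity α |x| := hmix.anti _ _ (by simp)
      _ ≤ D * |x| ^ (-(1 + α)) := by
        rw [refDensity_eq h0, hD, mul_assoc]
        exact mul_le_mul_of_nonneg_left (hle _ hxpos) (by positivity)
      _ ≤ (D + refDensity α 0) * (2 ^ (1 + α) * (1 + |x|) ^ (-(1 + α))) :=
        mul_le_mul (by linarith) h3 (by positivity) (by positivity)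
      _ = _ := by ring

theorem integrable_one_add_abs_rpow {r : ℝ} (hr : 1 < r) :
    Integrable fun x : ℝ => (1 + |x|) ^ (-r) := by
  simpa using integrable_one_add_norm (E := ℝ) (μ := volume) (r := r) (by simpa using hr)

theorem integrable_refDensity (h0 : 0 < α) (h2 : α ≤ 2) : Integrable (refDensity α) := by
  obtain ⟨K, hK, hle⟩ := refDensity_le h0 h2
  refine ((integrable_one_add_abs_rpow (r := 1 + α) (by linarith)).const_mul K).mono'
    (continuous_refDensity h0).aestronglyMeasurable (ae_of_all _ fun x => ?_)
  rw [Real.norm_of_nonneg (refDensity_pos h0 h2 x).le]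
  exact hle x

/-- Abel summation: insert the factor `exp (-(r x)²)`, apply the Gaussian Parseval identity and let
`r → 0`. The tail bound justifies the limit on one side; the other tends to `√π · ψ(0) ∫ exp (-v²/4)
= 2π`. -/
theorem integral_refDensity (h0 : 0 < α) (h2 : α ≤ 2) : ∫ x, refDensity α x = 1 := by
  have ha : 0 < 1 / α := by positivity
  have hψ := integrable_exp_neg_mul_abs_rpow ha h0
  set ψ : ℝ → ℝ := fun ω => Real.exp (-(1 / α * |ω| ^ α)) with hψdef
  have hFi : Integrable (cosTransform ψ) := by
    have := (integrable_refDensity h0 h2).const_mul (2 * Real.pi)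
    refine this.congr (ae_of_all _ fun x => ?_)
    simp only
    rw [refDensity_eq h0, mul_inv_cancel_left₀ (by positivity)]
  have hr0 : Tendsto (fun n : ℕ => 1 / ((n : ℝ) + 1)) atTop (𝓝 0) :=
    tendsto_one_div_add_atTop_nhds_zero_nat
  have hL : Tendsto (fun n : ℕ => ∫ x, cosTransform ψ x *
      Real.exp (-((1 / ((n : ℝ) + 1) * x) ^ 2))) atTop (𝓝 (∫ x, cosTransform ψ x)) := by
    refine tendsto_integral_of_dominated_convergence (fun x => |cosTransform ψ x|)
      (fun n => hFi.aestronglyMeasurable.mul (by fun_prop)) hFi.abs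
      (fun n => ae_of_all _ fun x => ?_) (ae_of_all _ fun x => ?_)
    · rw [Real.norm_eq_abs, abs_mul, Real.abs_exp]
      exact mul_le_of_le_one_right (abs_nonneg _) (Real.exp_le_one_iff.2 (by nlinarith))
    · have : Continuous fun r : ℝ => cosTransform ψ x * Real.exp (-((r * x) ^ 2)) := by fun_prop
      simpa [Function.comp_def] using (this.tendsto 0).comp hr0
  have hR : Tendsto (fun n : ℕ => Real.sqrt Real.pi * ∫ v, ψ (1 / ((n : ℝ) + 1) * v) *
      Real.exp (-(v ^ 2 / 4))) atTop
      (𝓝 (Real.sqrt Real.pi * ∫ v : ℝ, Real.exp (-(v ^ 2 / 4)))) := by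
    refine Tendsto.const_mul _ ?_
    refine tendsto_integral_of_dominated_convergence (fun v => Real.exp (-(v ^ 2 / 4)))
      (fun n => (integrable_stable_mul_gaussian ha _).aestronglyMeasurable)
      integrable_exp_neg_sq_div_four
      (fun n => ae_of_all _ fun v => ?_) (ae_of_all _ fun v => ?_)
    · rw [Real.norm_eq_abs, abs_mul, Real.abs_exp, Real.abs_exp]
      refine mul_le_of_le_one_left (Real.exp_pos _).le (Real.exp_le_one_iff.2 ?_)
      have : 0 ≤ 1 / α * |1 / ((n : ℝ) + 1) * v| ^ α := by positivity
      linarith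
    · have : Continuous fun r : ℝ => ψ (r * v) * Real.exp (-(v ^ 2 / 4)) := by
        have hc : Continuous ψ := by
          simp only [hψdef]
          exact (continuous_const.mul
            (continuous_abs.rpow_const fun _ => Or.inr h0.le)).neg.rexp
        fun_prop
      have h := (this.tendsto 0).comp hr0
      have hz : ψ 0 = 1 := by simp [hψdef, Real.zero_rpow h0.ne']
      simpa [Function.comp_def, hz] using h
  have heq : ∀ n : ℕ, ∫ x, cosTransform ψ x * Real.exp (-((1 / ((n : ℝ) + 1) * x) ^ 2)) =
      Real.sqrt Real.pi * ∫ v, ψ (1 / ((n : ℝ) + 1) * v) * Real.exp (-(v ^ 2 / 4)) := fun n =>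
    integral_cosTransform_mul_gaussian hψ (by positivity)
  simp only [heq] at hL
  have hval := tendsto_nhds_unique hL hR
  have hg : ∫ v : ℝ, Real.exp (-(v ^ 2 / 4)) = Real.sqrt (Real.pi / (1 / 4)) := by
    rw [← integral_gaussian]
    congr 1; ext v; ring_nf
  rw [funext (refDensity_eq h0), integral_const_mul, hval, hg,
    ← Real.sqrt_mul Real.pi_pos.le, show Real.pi * (Real.pi / (1 / 4)) = (2 * Real.pi) ^ 2 by ring,
    Real.sqrt_sq (by positivity), inv_mul_cancel₀ (by positivity)]

/-- From `log y ≤ y^η / η`, the integrand is at most a constant times `f^(1 - η)`, which still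
decays integrably for small `η`. Without integrability the integral defining `refEntropy` would take
the default value `0`. -/
theorem integrable_refDensity_mul_log_sub (h0 : 0 < α) (h2 : α ≤ 2) :
    Integrable fun x => refDensity α x * (Real.log (refDensity α 0) -
      Real.log (refDensity α x)) := by
  obtain ⟨K, hK, hle⟩ := refDensity_le h0 h2
  have hpos := refDensity_pos h0 h2
  have hmix := refDensity_isGaussianMixtureLike h0 h2
  set m := refDensity α 0 with hm
  have hm0 : 0 < m := hpos 0
  -- Chosen so that the tail exponent becomes `(1 + α)(1 - η) = 1 + α/2 > 1`.
  set η : ℝ := α / (2 * (1 + α)) with hη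
  have hη0 : 0 < η := by positivity
  have hη1 : 0 < 1 - η := by
    rw [sub_pos, hη, div_lt_one (by positivity)]; linarith
  have hexp : (1 + α) * (1 - η) = 1 + α / 2 := by rw [hη]; field_simp; ring
  have hcont : Continuous fun x => refDensity α x * (Real.log m - Real.log (refDensity α x)) :=
    (continuous_refDensity h0).mul (continuous_const.sub
      ((continuous_refDensity h0).log fun x => (hpos x).ne'))
  refine ((integrable_one_add_abs_rpow (r := 1 + α / 2) (by linarith)).const_mul
    (m ^ η / η * K ^ (1 - η))).mono' hcont.aestronglyMeasurable (ae_of_all _ fun x => ?_)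
  have hfx := hpos x
  have hlog : 0 ≤ Real.log m - Real.log (refDensity α x) :=
    sub_nonneg.2 (Real.log_le_log hfx (hmix.anti _ _ (by simp)))
  rw [Real.norm_of_nonneg (mul_nonneg hfx.le hlog)]
  have h1 : Real.log m - Real.log (refDensity α x) ≤ m ^ η / η * refDensity α x ^ (-η) := by
    rw [← Real.log_div hm0.ne' hfx.ne']
    refine (Real.log_le_rpow_div (by positivity) hη0).trans (le_of_eq ?_)
    rw [Real.div_rpow hm0.le hfx.le, Real.rpow_neg hfx.le]
    ring
  have hb : 0 < 1 + |x| := by positivity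
  calc _ ≤ refDensity α x * (m ^ η / η * refDensity α x ^ (-η)) :=
        mul_le_mul_of_nonneg_left h1 hfx.le
    _ = m ^ η / η * refDensity α x ^ (1 - η) := by
        rw [sub_eq_add_neg, Real.rpow_add hfx, Real.rpow_one]; ring
    _ ≤ m ^ η / η * (K * (1 + |x|) ^ (-(1 + α))) ^ (1 - η) := by
        gcongr
        exact hle x
    _ = _ := by
        rw [Real.mul_rpow hK.le (by positivity), ← Real.rpow_mul hb.le, neg_mul, hexp, mul_assoc]

/-- As `f` has mass one, the gap is `∫ f (log f(0) - log f)`, with continuous nonnegative integrand.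
It vanishes identically only if `f` is constant, which integrability and positivity exclude. -/
theorem neg_log_refDensity_zero_lt_refEntropy (h0 : 0 < α) (h2 : α ≤ 2) :
    -Real.log (refDensity α 0) < refEntropy α := by
  have hpos := refDensity_pos h0 h2
  have hmix := refDensity_isGaussianMixtureLike h0 h2
  have hint := integrable_refDensity_mul_log_sub h0 h2
  have hcont : Continuous fun x => refDensity α x * (Real.log (refDensity α 0) -
      Real.log (refDensity α x)) :=
    (continuous_refDensity h0).mul (continuous_const.sub
      ((continuous_refDensity h0).log fun x => (hpos x).ne'))
  obtain ⟨x, hx⟩ : ∃ x, refDensity α x ≠ refDensity α 0 := by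
    by_contra! h
    have := integrable_refDensity h0 h2
    rw [funext h, integrable_const_iff] at this
    simp [(hpos 0).ne', isFiniteMeasure_iff] at this
  have hlt : 0 < ∫ x, refDensity α x * (Real.log (refDensity α 0) -
      Real.log (refDensity α x)) := by
    refine integral_pos_of_integrable_nonneg_nonzero hcont hint (x := x) (fun y => ?_) ?_
    · exact mul_nonneg (hpos y).le (sub_nonneg.2 (Real.log_le_log (hpos y)
        (hmix.anti _ _ (by simp))))
    · refine mul_ne_zero (hpos x).ne' (sub_ne_zero.2 fun h => hx ?_)
      exact (Real.log_injOn_pos (hpos 0) (hpos x) h).symm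
  have hI1 := (integrable_refDensity h0 h2).mul_const (Real.log (refDensity α 0))
  have e : ∫ x, refDensity α x * Real.log (refDensity α x) = Real.log (refDensity α 0) -
      ∫ x, refDensity α x * (Real.log (refDensity α 0) - Real.log (refDensity α x)) := by
    have h3 : ∫ x, (refDensity α x * Real.log (refDensity α 0) - refDensity α x *
        (Real.log (refDensity α 0) - Real.log (refDensity α x))) = _ := integral_sub hI1 hint
    rw [integral_mul_const, integral_refDensity h0 h2, one_mul] at h3
    rw [← h3]
    congr 1; ext x; ring
  rw [refEntropy, e]
  linarith

end RefDensity

/-! ### Equidistribution of the normalized quantization error -/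

section Equidistribution

variable {Ω : Type*} [MeasurableSpace Ω] {P : Measure Ω}

theorem intervalIntegral_fourier_of_ne_zero {n : ℤ} (hn : n ≠ 0) :
    ∫ x in (-(1 / 2 : ℝ))..(1 / 2), fourier n ((x : ℝ) : AddCircle (1 : ℝ)) = 0 := by
  have hc : (2 * Real.pi * Complex.I * n : ℂ) ≠ 0 := by
    simp [Real.pi_ne_zero, Complex.I_ne_zero, hn]
  have e : ∀ x : ℝ, fourier n ((x : ℝ) : AddCircle (1 : ℝ)) =
      Complex.exp ((2 * Real.pi * Complex.I * n) * x) := fun x => by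
    rw [fourier_coe_apply]; simp
  simp only [e]
  rw [integral_exp_mul_complex hc, div_eq_zero_iff]
  left
  rw [sub_eq_zero, Complex.exp_eq_exp_iff_exists_int]
  exact ⟨n, by push_cast; ring⟩

/-- The expectation is the Fourier transform of the density at `-n / Δ`, so Riemann–Lebesgue
applies. This is where absolute continuity of `X` is essential. -/
theorem tendsto_integral_fourier_div [IsProbabilityMeasure P] {X : Ω → ℝ} (hX : HasPDF X P volume)
    {n : ℤ} (hn : n ≠ 0) :
    Tendsto (fun Δ : ℝ => ∫ w, fourier n ((X w / Δ : ℝ) : AddCircle (1 : ℝ)) ∂P)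
      (𝓝[>] 0) (𝓝 0) := by
  have hRL := Real.tendsto_integral_exp_smul_cocompact
    (fun v : ℝ => (((pdf X P volume v).toReal : ℝ) : ℂ))
  have hw : Tendsto (fun Δ : ℝ => (-n : ℝ) * Δ⁻¹) (𝓝[>] 0) (cocompact ℝ) := by
    have h1 : Tendsto (fun Δ : ℝ => Δ⁻¹) (𝓝[>] 0) (cocompact ℝ) :=
      tendsto_inv_nhdsGT_zero.mono_right atTop_le_cocompact
    have hn' : (-n : ℝ) ≠ 0 := by simpa using hn
    exact (Homeomorph.mulLeft₀ (-n : ℝ) hn').isClosedEmbedding.tendsto_cocompact.comp h1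
  refine (hRL.comp hw).congr fun Δ => ?_
  rw [← pdf.integral_pdf_smul (X := X) (μ := volume)
    (f := fun x : ℝ => fourier n ((x / Δ : ℝ) : AddCircle (1 : ℝ)))
    (Measurable.aestronglyMeasurable (by fun_prop))]
  simp only [Function.comp_apply]
  congr 1; ext v
  rw [Circle.smul_def, Real.fourierChar_apply, fourier_coe_apply, smul_eq_mul, mul_comm,
    Complex.real_smul]
  congr 2
  push_cast
  ring

/-- Weyl's argument: the claim holds for characters, hence for trigonometric polynomials, and passes
to their uniform limits, both sides being 1-Lipschitz in the sup norm. -/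
theorem tendsto_integral_addCircle_div [IsProbabilityMeasure P] {X : Ω → ℝ}
    (hX : HasPDF X P volume) (Φ : C(AddCircle (1 : ℝ), ℂ)) :
    Tendsto (fun Δ : ℝ => ∫ w, Φ ((X w / Δ : ℝ) : AddCircle (1 : ℝ)) ∂P) (𝓝[>] 0)
      (𝓝 (∫ x in (-(1 / 2 : ℝ))..(1 / 2), Φ ((x : ℝ) : AddCircle (1 : ℝ)))) := by
  have hXm : AEMeasurable X P := HasPDF.aemeasurable X P volume
  have hmk : Measurable fun x : ℝ => (x : AddCircle (1 : ℝ)) :=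
    (AddCircle.continuous_mk' (1 : ℝ)).measurable
  have hint : ∀ (Ψ : C(AddCircle (1 : ℝ), ℂ)) (Δ : ℝ),
      Integrable (fun w => Ψ ((X w / Δ : ℝ) : AddCircle (1 : ℝ))) P := fun Ψ Δ =>
    Integrable.of_bound (C := ‖Ψ‖)
      (Ψ.continuous.measurable.comp_aemeasurable
        (hmk.comp_aemeasurable (hXm.div_const Δ))).aestronglyMeasurable
      (ae_of_all _ fun w => Ψ.norm_coe_le_norm _)
  have hint' : ∀ Ψ : C(AddCircle (1 : ℝ), ℂ), IntervalIntegrable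
      (fun x : ℝ => Ψ (x : AddCircle (1 : ℝ))) volume (-(1 / 2)) (1 / 2) := fun Ψ =>
    (Ψ.continuous.comp (AddCircle.continuous_mk' (1 : ℝ))).intervalIntegrable _ _
  have hspan : ∀ Ψ ∈ Submodule.span ℂ (Set.range (@fourier 1)),
      Tendsto (fun Δ : ℝ => ∫ w, Ψ ((X w / Δ : ℝ) : AddCircle (1 : ℝ)) ∂P) (𝓝[>] 0)
      (𝓝 (∫ x in (-(1 / 2 : ℝ))..(1 / 2), Ψ ((x : ℝ) : AddCircle (1 : ℝ)))) := by
    intro Ψ hΨ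
    induction hΨ using Submodule.span_induction with
    | mem Ψ h =>
      obtain ⟨n, rfl⟩ := h
      by_cases hn : n = 0
      · subst hn
        simp only [fourier_zero, integral_const, intervalIntegral.integral_const]
        norm_num
      · rw [intervalIntegral_fourier_of_ne_zero hn]
        exact tendsto_integral_fourier_div hX hn
    | zero => simp
    | add Ψ₁ Ψ₂ _ _ h1 h2 =>
      simp only [ContinuousMap.add_apply]
      rw [intervalIntegral.integral_add (hint' _) (hint' _)]
      refine (h1.add h2).congr fun Δ => ?_
      rw [integral_add (hint _ _) (hint _ _)]
    | smul c Ψ _ h =>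
      simp only [ContinuousMap.smul_apply, integral_smul, intervalIntegral.integral_smul]
      exact h.const_smul c
  rw [Metric.tendsto_nhds]
  intro ε hε
  have hmem : Φ ∈ closure (Submodule.span ℂ (Set.range (@fourier 1)) :
      Set C(AddCircle (1 : ℝ), ℂ)) := by
    rw [← Submodule.topologicalClosure_coe, span_fourier_closure_eq_top]
    trivial
  obtain ⟨Ψ, hΨ, hd⟩ := Metric.mem_closure_iff.1 hmem (ε / 3) (by positivity)
  rw [dist_eq_norm] at hd
  filter_upwards [Metric.tendsto_nhds.1 (hspan Ψ hΨ) (ε / 3) (by positivity)] with Δ hΔ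
  have h1 : dist (∫ w, Φ ((X w / Δ : ℝ) : AddCircle (1 : ℝ)) ∂P)
      (∫ w, Ψ ((X w / Δ : ℝ) : AddCircle (1 : ℝ)) ∂P) ≤ ‖Φ - Ψ‖ := by
    rw [dist_eq_norm, ← integral_sub (hint _ _) (hint _ _)]
    refine (norm_integral_le_of_norm_le_const (C := ‖Φ - Ψ‖)
      (ae_of_all _ fun w => (Φ - Ψ).norm_coe_le_norm _)).trans ?_
    simp
  have h2 : dist (∫ x in (-(1 / 2 : ℝ))..(1 / 2), Ψ ((x : ℝ) : AddCircle (1 : ℝ)))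
      (∫ x in (-(1 / 2 : ℝ))..(1 / 2), Φ ((x : ℝ) : AddCircle (1 : ℝ))) ≤ ‖Φ - Ψ‖ := by
    rw [dist_comm, dist_eq_norm, ← intervalIntegral.integral_sub (hint' _) (hint' _)]
    refine (intervalIntegral.norm_integral_le_of_norm_le_const (C := ‖Φ - Ψ‖)
      fun x _ => (Φ - Ψ).norm_coe_le_norm _).trans (le_of_eq ?_)
    norm_num
  calc _ ≤ _ + _ + _ := dist_triangle4 _ _ _ _
    _ < ε / 3 + ε / 3 + ε / 3 := by gcongr <;> linarith
    _ = ε := by ring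

/-- The normalized quantization error `X / Δ - round (X / Δ)` is asymptotically uniform. -/
theorem tendsto_integral_quantizationError [IsProbabilityMeasure P] {X : Ω → ℝ}
    (hX : HasPDF X P volume) {φ : ℝ → ℝ} (hφ : Continuous φ) (heven : ∀ x, φ (-x) = φ x) :
    Tendsto (fun Δ : ℝ => ∫ w, φ ((X w - uniformQuantizer Δ (X w)) / Δ) ∂P) (𝓝[>] 0)
      (𝓝 (∫ x in (-(1 / 2 : ℝ))..(1 / 2), φ x)) := by
  -- Evenness matches the values at `±1/2`, so `φ` descends to a continuous function on the circle.
  have hend : ((φ (-(1 / 2)) : ℝ) : ℂ) = (φ (-(1 / 2) + 1) : ℝ) := by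
    rw [heven]; norm_num
  let Φ : C(AddCircle (1 : ℝ), ℂ) :=
    ⟨AddCircle.liftIoc 1 (-(1 / 2)) (fun x => ((φ x : ℝ) : ℂ)),
      AddCircle.liftIoc_continuous hend (by fun_prop)⟩
  have hΦ : ∀ x ∈ Set.Ioc (-(1 / 2) : ℝ) (1 / 2), Φ (x : AddCircle (1 : ℝ)) = φ x := fun x hx =>
    AddCircle.liftIoc_coe_apply (f := fun x => ((φ x : ℝ) : ℂ))
      (by rwa [show (-(1 / 2) + 1 : ℝ) = 1 / 2 by norm_num])
  have h := (Complex.continuous_re.tendsto _).comp (tendsto_integral_addCircle_div hX Φ)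
  have hlim : ∫ x in (-(1 / 2 : ℝ))..(1 / 2), Φ ((x : ℝ) : AddCircle (1 : ℝ)) =
      ((∫ x in (-(1 / 2 : ℝ))..(1 / 2), φ x : ℝ) : ℂ) := by
    rw [← intervalIntegral.integral_ofReal]
    refine intervalIntegral.integral_congr_uIoo fun x hx => hΦ x ?_
    rw [Set.uIoo_of_le (by norm_num)] at hx
    exact Set.Ioo_subset_Ioc_self hx
  rw [hlim, Complex.ofReal_re] at h
  refine h.congr' ?_
  filter_upwards [self_mem_nhdsWithin] with Δ hΔ
  have hΔ0 : Δ ≠ 0 := (ne_of_gt hΔ)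
  have e : ∀ w, Φ ((X w / Δ : ℝ) : AddCircle (1 : ℝ)) =
      ((φ ((X w - uniformQuantizer Δ (X w)) / Δ) : ℝ) : ℂ) := fun w => by
    have hv : (X w - uniformQuantizer Δ (X w)) / Δ = X w / Δ - ⌈X w / Δ - 1 / 2⌉ := by
      rw [uniformQuantizer, sub_div, mul_div_cancel_right₀ _ hΔ0]
    rw [hv, ← hΦ]
    · congr 1
      rw [AddCircle.coe_sub]
      have : ((⌈X w / Δ - 1 / 2⌉ : ℝ) : AddCircle (1 : ℝ)) = 0 := by
        rw [AddCircle.coe_eq_zero_iff]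
        exact ⟨⌈X w / Δ - 1 / 2⌉, by simp⟩
      rw [this, sub_zero]
    · have h1 := Int.le_ceil (X w / Δ - 1 / 2)
      have h2 := Int.ceil_lt_add_one (X w / Δ - 1 / 2)
      constructor <;> linarith
  simp only [Function.comp_apply, e, integral_complex_ofReal, Complex.ofReal_re]

theorem abs_sub_uniformQuantizer_le {Δ : ℝ} (hΔ : 0 < Δ) (x : ℝ) :
    |x - uniformQuantizer Δ x| ≤ Δ / 2 := by
  have h1 := Int.le_ceil (x / Δ - 1 / 2)
  have h2 := Int.ceil_lt_add_one (x / Δ - 1 / 2)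
  have e : x - uniformQuantizer Δ x = (x / Δ - ⌈x / Δ - 1 / 2⌉) * Δ := by
    rw [uniformQuantizer]; field_simp
  rw [e, abs_mul, abs_of_pos hΔ]
  have : |x / Δ - ⌈x / Δ - 1 / 2⌉| ≤ 1 / 2 := by
    rw [abs_le]; constructor <;> linarith
  nlinarith

theorem measurable_uniformQuantizer (Δ : ℝ) : Measurable (uniformQuantizer Δ) := by
  unfold uniformQuantizer
  fun_prop

theorem integral_comp_uniform {U : Ω → ℝ} [IsProbabilityMeasure P]
    (hU : pdf.IsUniform U (Set.Ioo (-(1 / 2 : ℝ)) (1 / 2)) P volume) {φ : ℝ → ℝ}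
    (hφ : Continuous φ) : ∫ w, φ (U w) ∂P = ∫ x in (-(1 / 2 : ℝ))..(1 / 2), φ x := by
  have hv : volume (Set.Ioo (-(1 / 2 : ℝ)) (1 / 2)) = 1 := by
    rw [Real.volume_Ioo]; norm_num
  have hm : AEMeasurable U P := hU.aemeasurable (by rw [hv]; simp) (by rw [hv]; simp)
  rw [← integral_map hm hφ.aestronglyMeasurable, hU, ProbabilityTheory.cond, hv, inv_one, one_smul,
    intervalIntegral.integral_of_le (by norm_num), integral_Ioc_eq_integral_Ioo]

theorem ae_abs_uniform_le {U : Ω → ℝ} [IsProbabilityMeasure P]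
    (hU : pdf.IsUniform U (Set.Ioo (-(1 / 2 : ℝ)) (1 / 2)) P volume) :
    AEMeasurable U P ∧ ∀ᵐ w ∂P, |U w| ≤ 1 / 2 := by
  have hv : volume (Set.Ioo (-(1 / 2 : ℝ)) (1 / 2)) = 1 := by
    rw [Real.volume_Ioo]; norm_num
  have hm : AEMeasurable U P := hU.aemeasurable (by rw [hv]; simp) (by rw [hv]; simp)
  refine ⟨hm, ae_of_ae_map (p := fun x => |x| ≤ 1 / 2) hm ?_⟩
  rw [hU]
  filter_upwards [ae_cond_mem measurableSet_Ioo] with x hx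
  exact abs_le.2 ⟨hx.1.le, hx.2.le⟩

end Equidistribution

/-! ### Levels, strengths and their convergence -/

section Strength

variable {Ω : Type*} [MeasurableSpace Ω] {P : Measure Ω} {α : ℝ}

theorem continuous_log_refDensity (h0 : 0 < α) (h2 : α ≤ 2) :
    Continuous fun x => Real.log (refDensity α x) :=
  (continuous_refDensity h0).log fun x => (refDensity_pos h0 h2 x).ne'

theorem log_refDensity_anti (h0 : 0 < α) (h2 : α ≤ 2) {x y : ℝ} (h : |x| ≤ |y|) :
    Real.log (refDensity α y) ≤ Real.log (refDensity α x) :=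
  Real.log_le_log (refDensity_pos h0 h2 y) ((refDensity_isGaussianMixtureLike h0 h2).anti x y h)

theorem integrable_log_refDensity_div [IsProbabilityMeasure P] (h0 : 0 < α) (h2 : α ≤ 2)
    {Y : Ω → ℝ} (hY : AEMeasurable Y P) {M : ℝ} (hM : ∀ᵐ w ∂P, |Y w| ≤ M) (s : ℝ) :
    Integrable (fun w => Real.log (refDensity α (Y w / s))) P := by
  refine Integrable.of_mem_Icc (Real.log (refDensity α (M / s))) (Real.log (refDensity α 0))
    ((continuous_log_refDensity h0 h2).measurable.comp_aemeasurable (hY.div_const s)) ?_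
  filter_upwards [hM] with w hw
  refine ⟨log_refDensity_anti h0 h2 ?_, log_refDensity_anti h0 h2 (by simp)⟩
  rw [abs_div, abs_div]
  exact div_le_div_of_nonneg_right (hw.trans (le_abs_self M)) (abs_nonneg s)

theorem strengthSet_upward [IsProbabilityMeasure P] (h0 : 0 < α) (h2 : α ≤ 2) {Y : Ω → ℝ}
    (hY : AEMeasurable Y P) {M : ℝ} (hM : ∀ᵐ w ∂P, |Y w| ≤ M) {s t : ℝ}
    (hs : s ∈ strengthSet α Y P) (hst : s ≤ t) : t ∈ strengthSet α Y P := by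
  obtain ⟨hs0, hsi, hsle⟩ := hs
  have ht0 : 0 < t := hs0.trans_le hst
  have hti := integrable_log_refDensity_div h0 h2 hY hM t
  refine ⟨ht0, hti, le_trans (neg_le_neg ?_) hsle⟩
  refine integral_mono hsi hti fun w => log_refDensity_anti h0 h2 ?_
  rw [abs_div, abs_div, abs_of_pos hs0, abs_of_pos ht0]
  gcongr

/-- As `s → ∞` the level is at most `-log f(M / s) → -log f(0)`, which is strictly below the
entropy. -/
theorem strengthExists_of_bounded [IsProbabilityMeasure P] (h0 : 0 < α) (h2 : α ≤ 2) {Y : Ω → ℝ}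
    (hY : AEMeasurable Y P) {M : ℝ} (hM : ∀ᵐ w ∂P, |Y w| ≤ M) : StrengthExists α Y P := by
  have hlim : Tendsto (fun s : ℝ => -Real.log (refDensity α (M / s))) atTop
      (𝓝 (-Real.log (refDensity α 0))) :=
    (((continuous_log_refDensity h0 h2).tendsto 0).comp
      (tendsto_const_nhds.div_atTop tendsto_id)).neg
  obtain ⟨s, hs, hs0⟩ := ((hlim.eventually_lt_const
    (neg_log_refDensity_zero_lt_refEntropy h0 h2)).and (eventually_gt_atTop 0)).exists
  have hi := integrable_log_refDensity_div h0 h2 hY hM s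
  refine ⟨s, hs0, hi, le_trans (neg_le_neg ?_) hs.le⟩
  calc Real.log (refDensity α (M / s)) = ∫ _, Real.log (refDensity α (M / s)) ∂P := by simp
    _ ≤ _ := by
      refine integral_mono_ae (integrable_const _) hi ?_
      filter_upwards [hM] with w hw
      refine log_refDensity_anti h0 h2 ?_
      rw [abs_div, abs_div]
      exact div_le_div_of_nonneg_right (hw.trans (le_abs_self M)) (abs_nonneg s)

theorem strength_nonneg (Y : Ω → ℝ) : 0 ≤ strength α Y P :=
  Real.sInf_nonneg fun _ hs => hs.1.le

theorem bddBelow_strengthSet (Y : Ω → ℝ) : BddBelow (strengthSet α Y P) :=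
  ⟨0, fun _ hs => hs.1.le⟩

theorem eq_apply_zero_of_forall_contract {g : ℝ → ℝ} (hg : ContinuousAt g 0) {q r : ℝ}
    (hq0 : 0 ≤ q) (hq1 : q < 1) (h : ∀ v, |v| ≤ r → g (q * v) = g v) {v : ℝ} (hv : |v| ≤ r) :
    g v = g 0 := by
  have hall : ∀ n : ℕ, g (q ^ n * v) = g v := by
    intro n
    induction n with
    | zero => simp
    | succ n ih =>
      rw [pow_succ', mul_assoc, h _ ?_, ih]
      rw [abs_mul, abs_of_nonneg (pow_nonneg hq0 n)]
      exact (mul_le_of_le_one_left (abs_nonneg v) (pow_le_one₀ hq0 hq1.le)).trans hv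
  have hlim : Tendsto (fun n : ℕ => q ^ n * v) atTop (𝓝 0) := by
    simpa using (tendsto_pow_atTop_nhds_zero_of_lt_one hq0 hq1).mul_const v
  have h2 : Tendsto (fun n : ℕ => g (q ^ n * v)) atTop (𝓝 (g 0)) := hg.tendsto.comp hlim
  simp only [hall] at h2
  exact tendsto_nhds_unique tendsto_const_nhds h2

/-- Some `s < t` has level at most the entropy. Either the level drops strictly from `s` to `t`, or
`log f` is constant near `0` and the level at `t` is `-log f(0)`, again strictly below the entropy.
-/
theorem lt_refEntropy_of_strength_uniform_lt [IsProbabilityMeasure P] (h0 : 0 < α) (h2 : α ≤ 2)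
    {U : Ω → ℝ} (hU : pdf.IsUniform U (Set.Ioo (-(1 / 2 : ℝ)) (1 / 2)) P volume) {t : ℝ}
    (ht : strength α U P < t) :
    -(∫ x in (-(1 / 2 : ℝ))..(1 / 2), Real.log (refDensity α (x / t))) < refEntropy α := by
  have hc := continuous_log_refDensity h0 h2
  obtain ⟨hm, hb⟩ := ae_abs_uniform_le hU
  obtain ⟨s, hs, hst⟩ := exists_lt_of_csInf_lt (strengthExists_of_bounded h0 h2 hm hb) ht
  obtain ⟨hs0, -, hsle⟩ := hs
  have ht0 : 0 < t := hs0.trans hst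
  have hcont : ∀ r : ℝ, Continuous fun x : ℝ => Real.log (refDensity α (x / r)) := fun r =>
    hc.comp (continuous_id.div_const r)
  rw [integral_comp_uniform hU (φ := fun x => Real.log (refDensity α (x / s))) (hcont s)] at hsle
  have hle : ∀ x : ℝ, Real.log (refDensity α (x / s)) ≤ Real.log (refDensity α (x / t)) := by
    intro x
    refine log_refDensity_anti h0 h2 ?_
    rw [abs_div, abs_div, abs_of_pos hs0, abs_of_pos ht0]
    gcongr
  by_cases hex : ∃ c ∈ Set.Icc (-(1 / 2 : ℝ)) (1 / 2),
      Real.log (refDensity α (c / s)) < Real.log (refDensity α (c / t))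
  · have := intervalIntegral.integral_lt_integral_of_continuousOn_of_le_of_exists_lt
      (a := -(1 / 2 : ℝ)) (b := 1 / 2) (by norm_num) (hcont s).continuousOn (hcont t).continuousOn
      (fun x _ => hle x) hex
    linarith
  · push Not at hex
    -- Equality at `c / s` and `c / t` for all `|c| ≤ 1/2` makes `log f` invariant under contraction
    -- by `s / t < 1`, hence equal to its value at `0`.
    have hconst : ∀ v : ℝ, |v| ≤ 1 / 2 / s →
        Real.log (refDensity α v) = Real.log (refDensity α 0) := by
      intro v hv
      refine eq_apply_zero_of_forall_contract (g := fun x => Real.log (refDensity α x))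
        hc.continuousAt (q := s / t) (r := 1 / 2 / s) (by positivity) ((div_lt_one ht0).2 hst) ?_ hv
      intro u hu
      have hu' : |s * u| ≤ 1 / 2 := by
        rw [abs_mul, abs_of_pos hs0]
        rwa [le_div_iff₀' hs0] at hu
      have := le_antisymm (hex (s * u) (abs_le.1 hu')) (hle (s * u))
      rw [mul_div_cancel_left₀ _ hs0.ne'] at this
      rw [← this]
      congr 2
      ring
    have e : ∫ x in (-(1 / 2 : ℝ))..(1 / 2), Real.log (refDensity α (x / t)) =
        Real.log (refDensity α 0) := by
      rw [intervalIntegral.integral_congr (g := fun _ => Real.log (refDensity α 0))]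
      · norm_num
      · intro x hx
        rw [Set.uIcc_of_le (by norm_num)] at hx
        refine hconst _ ?_
        rw [abs_div, abs_of_pos ht0]
        have := abs_le.2 hx
        gcongr
    rw [e]
    exact neg_log_refDensity_zero_lt_refEntropy h0 h2

theorem tendsto_strength_quantizationError {Ω' : Type*} [MeasurableSpace Ω'] {P' : Measure Ω'}
    [IsProbabilityMeasure P] [IsProbabilityMeasure P'] (h0 : 0 < α) (h2 : α ≤ 2)
    {X : Ω → ℝ} (hX : HasPDF X P volume) {U : Ω' → ℝ}
    (hU : pdf.IsUniform U (Set.Ioo (-(1 / 2 : ℝ)) (1 / 2)) P' volume) :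
    Tendsto (fun Δ : ℝ => strength α (fun w => X w - uniformQuantizer Δ (X w)) P / Δ)
      (𝓝[>] 0) (𝓝 (strength α U P')) := by
  have hXm : AEMeasurable X P := HasPDF.aemeasurable X P volume
  have hYm : ∀ Δ : ℝ, AEMeasurable (fun w => X w - uniformQuantizer Δ (X w)) P := fun Δ =>
    hXm.sub ((measurable_uniformQuantizer Δ).comp_aemeasurable hXm)
  have hYb : ∀ Δ : ℝ, 0 < Δ → ∀ᵐ w ∂P, |X w - uniformQuantizer Δ (X w)| ≤ Δ / 2 :=
    fun Δ hΔ => ae_of_all _ fun w => abs_sub_uniformQuantizer_le hΔ _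
  obtain ⟨hUm, hUb⟩ := ae_abs_uniform_le hU
  have hcont : ∀ r : ℝ, Continuous fun x : ℝ => Real.log (refDensity α (x / r)) := fun r =>
    (continuous_log_refDensity h0 h2).comp (continuous_id.div_const r)
  have hconv : ∀ t : ℝ, Tendsto (fun Δ : ℝ => -∫ w, Real.log
      (refDensity α ((X w - uniformQuantizer Δ (X w)) / (Δ * t))) ∂P) (𝓝[>] 0)
      (𝓝 (-∫ x in (-(1 / 2 : ℝ))..(1 / 2), Real.log (refDensity α (x / t)))) := by
    intro t
    have := (tendsto_integral_quantizationError hX (hcont t) fun x => by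
      rw [neg_div, (refDensity_isGaussianMixtureLike h0 h2).even]).neg
    simpa only [div_div] using this
  rw [tendsto_order]
  constructor
  · intro a ha
    rcases lt_or_ge a 0 with ha0 | ha0
    · filter_upwards [self_mem_nhdsWithin] with Δ hΔ
      exact ha0.trans_le (div_nonneg (strength_nonneg _) (le_of_lt hΔ))
    obtain ⟨t, hat, hts⟩ := exists_between ha
    have ht0 : 0 < t := ha0.trans_lt hat
    -- A positive `t` below the infimum is not in the set; integrability is automatic for bounded
    -- `U`, so the level inequality itself fails.
    have hnot : refEntropy α <
        -∫ x in (-(1 / 2 : ℝ))..(1 / 2), Real.log (refDensity α (x / t)) := by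
      by_contra! h
      refine (not_le.2 hts) (csInf_le (bddBelow_strengthSet U)
        ⟨ht0, integrable_log_refDensity_div h0 h2 hUm hUb _, ?_⟩)
      rwa [integral_comp_uniform hU (φ := fun x => Real.log (refDensity α (x / t))) (hcont t)]
    filter_upwards [(hconv t).eventually_const_lt hnot, self_mem_nhdsWithin] with Δ hlt hΔ
    have hΔ0 : 0 < Δ := hΔ
    refine hat.trans_le ((le_div_iff₀' hΔ0).2 ?_)
    -- By upward closure, a member `s < Δ * t` would put `Δ * t` in the set, contradicting `hlt`.
    refine le_csInf (strengthExists_of_bounded h0 h2 (hYm Δ) (hYb Δ hΔ)) fun s hs => ?_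
    by_contra! hcon
    exact (not_le.2 hlt) (strengthSet_upward h0 h2 (hYm Δ) (hYb Δ hΔ) hs hcon.le).2.2
  · intro b hb
    obtain ⟨t, hst, htb⟩ := exists_between hb
    have ht0 : 0 < t := (strength_nonneg U).trans_lt hst
    filter_upwards [(hconv t).eventually_lt_const
      (lt_refEntropy_of_strength_uniform_lt h0 h2 hU hst), self_mem_nhdsWithin] with Δ hlt hΔ
    have hΔ0 : 0 < Δ := hΔ
    refine lt_of_le_of_lt ((div_le_iff₀' hΔ0).2 ?_) htb
    exact csInf_le (bddBelow_strengthSet _) ⟨mul_pos hΔ0 ht0,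
      integrable_log_refDensity_div h0 h2 (hYm Δ) (hYb Δ hΔ) _, hlt.le⟩

/-! ### The Gaussian case `α = 2` -/

theorem refDensity_two (x : ℝ) : refDensity 2 x = gaussianPDFReal 0 1 x := by
  have h := cosTransform_gaussian (b := 1 / 2) (by norm_num) x
  rw [refDensity_eq two_pos]
  simp only [Real.rpow_two, sq_abs]
  rw [h, gaussianPDFReal]
  have e : Real.sqrt (Real.pi / (1 / 2)) = Real.sqrt (2 * Real.pi) := by ring_nf
  have e2 : (2 * Real.pi)⁻¹ * Real.sqrt (2 * Real.pi) = (Real.sqrt (2 * Real.pi))⁻¹ := by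
    have h1 : Real.sqrt (2 * Real.pi) ≠ 0 := by positivity
    nth_rewrite 1 [← Real.sq_sqrt (show 0 ≤ 2 * Real.pi by positivity)]
    field_simp
  rw [e, ← mul_assoc, e2]
  simp only [NNReal.coe_one, mul_one, sub_zero]
  congr 2
  ring

theorem log_refDensity_two (x : ℝ) :
    Real.log (refDensity 2 x) = Real.log (refDensity 2 0) - x ^ 2 / 2 := by
  have e : refDensity 2 x = refDensity 2 0 * Real.exp (-(x ^ 2 / 2)) := by
    simp only [refDensity_two, gaussianPDFReal]
    simp [neg_div]
  rw [e, Real.log_mul (refDensity_pos two_pos le_rfl 0).ne' (Real.exp_pos _).ne', Real.log_exp]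
  ring

theorem refEntropy_two : refEntropy 2 = -Real.log (refDensity 2 0) + 1 / 2 := by
  have hvar : ∫ x, refDensity 2 x * x ^ 2 = 1 := by
    have h1 := variance_fun_id_gaussianReal (μ := 0) (v := 1)
    rw [variance_eq_integral measurable_id'.aemeasurable, integral_id_gaussianReal,
      integral_gaussianReal_eq_integral_smul one_ne_zero] at h1
    simpa [refDensity_two] using h1
  -- A non-integrable function would have integral `0`, not `1`.
  have hi : Integrable fun x => refDensity 2 x * x ^ 2 := by
    by_contra h
    rw [integral_undef h] at hvar
    exact zero_ne_one hvar
  have h3 := integral_sub ((integrable_refDensity two_pos le_rfl).mul_const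
    (Real.log (refDensity 2 0))) (hi.div_const 2)
  rw [integral_mul_const, integral_div, hvar, integral_refDensity two_pos le_rfl] at h3
  have e : ∫ x, refDensity 2 x * Real.log (refDensity 2 x) = Real.log (refDensity 2 0) - 1 / 2 := by
    rw [← one_mul (Real.log (refDensity 2 0)), ← h3]
    congr 1; ext x
    rw [log_refDensity_two x]
    ring
  rw [refEntropy, e]
  ring

/-- Here `-log f` is quadratic and `E[U²] = 1/12`, so the level is `-log f(0) + 1/(24 s²)`, while
the entropy is `-log f(0) + 1/2`; the condition is `s² ≥ 1/12`. -/
theorem strength_two_uniform [IsProbabilityMeasure P] {U : Ω → ℝ}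
    (hU : pdf.IsUniform U (Set.Ioo (-(1 / 2 : ℝ)) (1 / 2)) P volume) :
    strength 2 U P = Real.sqrt (1 / 12) := by
  obtain ⟨hUm, hUb⟩ := ae_abs_uniform_le hU
  have hval : ∀ s : ℝ, ∫ w, Real.log (refDensity 2 (U w / s)) ∂P =
      Real.log (refDensity 2 0) - 1 / (24 * s ^ 2) := by
    intro s
    rw [integral_comp_uniform hU (φ := fun x => Real.log (refDensity 2 (x / s)))
      ((continuous_log_refDensity two_pos le_rfl).comp (continuous_id.div_const s))]
    simp only [fun x : ℝ => log_refDensity_two (x / s), div_pow, div_div]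
    rw [intervalIntegral.integral_sub (by simp) (Continuous.intervalIntegrable (by fun_prop) _ _),
      intervalIntegral.integral_div, integral_pow, intervalIntegral.integral_const]
    norm_num
    ring
  have hset : strengthSet 2 U P = Set.Ici (Real.sqrt (1 / 12)) := by
    ext s
    have hpos : 0 < Real.sqrt (1 / 12) := by positivity
    rw [Set.mem_Ici]
    have hiff : ∀ s : ℝ, 0 < s → (-(∫ w, Real.log (refDensity 2 (U w / s)) ∂P) ≤ refEntropy 2 ↔
        Real.sqrt (1 / 12) ≤ s) := by
      intro s hs
      rw [hval, refEntropy_two, Real.sqrt_le_left hs.le]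
      have : (1 : ℝ) / (24 * s ^ 2) ≤ 1 / 2 ↔ 1 / 12 ≤ s ^ 2 := by
        rw [div_le_div_iff₀ (by positivity) (by norm_num)]
        constructor <;> intro h <;> linarith
      rw [← this]
      constructor <;> intro h <;> linarith
    constructor
    · rintro ⟨h1, -, h3⟩
      exact (hiff s h1).1 h3
    · intro h
      have hs : 0 < s := hpos.trans_le h
      exact ⟨hs, integrable_log_refDensity_div two_pos le_rfl hUm hUb _, (hiff s hs).2 h⟩
  rw [strength, hset, csInf_Ici]

end Strength

theorem theorem3 {Ω Ω' : Type*} [MeasurableSpace Ω] [MeasurableSpace Ω']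
    (P : Measure Ω) [IsProbabilityMeasure P] (P' : Measure Ω') [IsProbabilityMeasure P']
    (α : ℝ) (hα0 : 0 < α) (hα2 : α ≤ 2)
    (X : Ω → ℝ) (hX : HasPDF X P volume) (hs : StrengthExists α X P)
    (U : Ω' → ℝ) (hU : pdf.IsUniform U (Set.Ioo (-(1 / 2 : ℝ)) (1 / 2)) P' volume) :
    StrengthExists α U P' ∧
    (∀ Δ : ℝ, 0 < Δ → StrengthExists α (fun w => X w - uniformQuantizer Δ (X w)) P) ∧
    Tendsto (fun Δ : ℝ => strength α (fun w => X w - uniformQuantizer Δ (X w)) P / Δ)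
      (𝓝[>] 0) (𝓝 (strength α U P')) ∧
    (α = 2 → strength α U P' = Real.sqrt (1 / 12)) := by
  obtain ⟨hUm, hUb⟩ := ae_abs_uniform_le hU
  have hXm : AEMeasurable X P := HasPDF.aemeasurable X P volume
  refine ⟨strengthExists_of_bounded hα0 hα2 hUm hUb, fun Δ hΔ => ?_,
    tendsto_strength_quantizationError hα0 hα2 hX hU, ?_⟩
  · exact strengthExists_of_bounded hα0 hα2
      (hXm.sub ((measurable_uniformQuantizer Δ).comp_aemeasurable hXm))
      (ae_of_all _ fun w => abs_sub_uniformQuantizer_le hΔ (X w))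
  · rintro rfl
    exact strength_two_uniform hU
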